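/- Let $d$ be a non-negative integer and let $\mathcal X$ be either $\mathbb R^d$ with $\nu$ the Lebesgue measure and $\mathcal X^*=\mathbb R^d$, or $\mathbb Z^d$ with $\nu$ the counting measure and $\mathcal X^*=[0,1]^d$. Write $|W|=\nu(W)$, let $\|\cdot\|$ be the Euclidean norm, and for $f\in L^1(\mathcal X,\nu)$ let $\hat f(x)=\int_{\mathcal X} f(t)e^{-2i\pi\langle t,x\rangle}\,d\nu(t)$, $x\in\mathcal X^*$. Let $\partial W$ denote the topological boundary of $W$ if $\mathcal X=\mathbb R^d$, and the set of points of $W$ having a nearest neighbour (a lattice point at $\ell^1$-distance $1$) outside $W$ if $\mathcal X=\mathbb Z^d$. Let $\Theta$ be any set, let $M<1$, and let $\{K_0^\theta:\mathcal X\to\mathbb R,\ \theta\in\Theta\}$ be a family of functions in $L^1(\mathcal X,\nu)$, continuous at the origin, whose Fourier transforms $\hat K_0^\theta$ are integrable on $\mathcal X^*$ and take values in $[0,M]$. (In the case $\mathcal X=\mathbb Z^d$ continuity, and integrability of $\hat K_0^\theta$, are automatic.) Assume that $\sup_{\theta\in\Theta}K_0^\theta(0)<\infty$ and that $x\mapsto\sup_{\theta\in\Theta}|K_0^\theta(x)|$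 is integrable on $(\mathcal X,\nu)$. Let $(W_n)_{n\ge 0}$ be a (weakly) increasing sequence of compact subsets of $\mathcal X$ with $\bigcup_n W_n=\mathcal X$, such that there is a (weakly) increasing sequence $r_n\ge 0$ with $r_n\to\infty$ and $$\big|\{x\in W_n:\ \|x-y\|\le r_n\text{ for some }y\in\partial W_n\}\big|=o(|W_n|)\quad (n\to\infty),$$ and such that $\sum_{n\ge 0}\exp(-\delta|W_n|)<\infty$ for all $\delta>0$. Let $\mathcal K^\theta_{W_n}$ be the projection on $L^2(W_n,\nu)$ of the integral operator on $L^2(\mathcal X,\nu)$ with kernel $(x,y)\mapsto K_0^\theta(x-y)$, and let $\mathcal I_{W_n}$ be the identity on $L^2(W_n,\nu)$. Then each $\mathcal K^\theta_{W_n}$ is self-adjoint, compact and of trace class, its Fredholm determinant $\det(\mathcal I_{W_n}-\mathcal K^\theta_{W_n})=\prod_i(1-\lambda_i)$, where the $\lambda_i$ are the eigenvalues of $\mathcal K^\theta_{W_n}$ repeated according to multiplicity, is positive, each function $\log(1-\hat K_0^\theta)$ is integrable on $\mathcal X^*$, and $$\sup_{\theta\in\Theta}\left|\frac{1}{|W_n|}\log\det(\mathcal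 I_{W_n}-\mathcal K^\theta_{W_n})-\int_{\mathcal X^*}\log\big(1-\hat K_0^\theta(x)\big)\,dx\right|\underset{n\to\infty}{\longrightarrow}0.$$ -/

import Mathlib

open MeasureTheory Filter Topology
open scoped ENNReal FourierTransform

/-! ### Convolution operators on `L²` and their compression to a window -/

section ConvolutionOperator

set_option linter.unusedSectionVars false

variable {X : Type*} [AddCommGroup X] [MeasurableSpace X] [MeasurableAdd₂ X] [MeasurableNeg X]
  {ν : Measure X} [SFinite ν] [ν.IsAddLeftInvariant] [ν.IsNegInvariant]

/-- The map `(x, y) ↦ k (x - y) * f y` is measurable on the product. -/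
theorem convKernel_aestronglyMeasurable {k : X → ℝ} (hk : AEStronglyMeasurable k ν)
    {f : X → ℂ} (hf : AEStronglyMeasurable f ν) :
    AEStronglyMeasurable (fun p : X × X => (k (p.1 - p.2) : ℂ) * f p.2) (ν.prod ν) := by
  have h1 : AEStronglyMeasurable (fun p : X × X => k (p.1 - p.2)) (ν.prod ν) :=
    hk.comp_quasiMeasurePreserving (quasiMeasurePreserving_sub_of_right_invariant ν ν)
  have h2 : AEStronglyMeasurable (fun p : X × X => f p.2) (ν.prod ν) := hf.comp_snd
  exact (Complex.continuous_ofReal.comp_aestronglyMeasurable h1).mul h2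

theorem convKernel_section_aemeasurable {k : X → ℝ} (hk : AEStronglyMeasurable k ν) (x : X) :
    AEMeasurable (fun y => ‖k (x - y)‖ₑ) ν :=
  (hk.comp_quasiMeasurePreserving
    (Measure.measurePreserving_sub_left ν x).quasiMeasurePreserving).enorm

/-- Schur's estimate for convolution kernels. -/
theorem lintegral_conv_sq_le {k : X → ℝ} (hk : AEStronglyMeasurable k ν)
    {f : X → ℂ} (hf : AEStronglyMeasurable f ν) :
    ∫⁻ x, (∫⁻ y, ‖(k (x - y) : ℂ) * f y‖ₑ ∂ν) ^ (2 : ℝ) ∂ν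
      ≤ (∫⁻ y, ‖k y‖ₑ ∂ν) ^ (2 : ℝ) * ∫⁻ y, ‖f y‖ₑ ^ (2 : ℝ) ∂ν := by
  set C := ∫⁻ y, ‖k y‖ₑ ∂ν with hC
  have hpt : ∀ x, (∫⁻ y, ‖(k (x - y) : ℂ) * f y‖ₑ ∂ν) ^ (2 : ℝ)
      ≤ C * ∫⁻ y, ‖k (x - y)‖ₑ * ‖f y‖ₑ ^ (2 : ℝ) ∂ν := by
    intro x
    have hkx := convKernel_section_aemeasurable hk x
    have hCS := ENNReal.lintegral_mul_le_Lp_mul_Lq ν Real.HolderConjugate.two_two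
      (f := fun y => ‖k (x - y)‖ₑ ^ (1 / 2 : ℝ))
      (g := fun y => ‖k (x - y)‖ₑ ^ (1 / 2 : ℝ) * ‖f y‖ₑ)
      (hkx.pow_const _) ((hkx.pow_const _).mul hf.enorm)
    have e1 : ∀ y, ((fun y => ‖k (x - y)‖ₑ ^ (1 / 2 : ℝ)) *
        (fun y => ‖k (x - y)‖ₑ ^ (1 / 2 : ℝ) * ‖f y‖ₑ)) y = ‖(k (x - y) : ℂ) * f y‖ₑ := by
      intro y
      simp only [Pi.mul_apply]
      rw [← mul_assoc, ← ENNReal.rpow_add_of_nonneg _ _ (by norm_num) (by norm_num), enorm_mul]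
      norm_num
      congr 1
      rw [← ofReal_norm, ← ofReal_norm, Complex.norm_real]
    have e2 : ∀ y, (‖k (x - y)‖ₑ ^ (1 / 2 : ℝ)) ^ (2 : ℝ) = ‖k (x - y)‖ₑ := by
      intro y
      rw [← ENNReal.rpow_mul]; norm_num
    have e3 : ∀ y, (‖k (x - y)‖ₑ ^ (1 / 2 : ℝ) * ‖f y‖ₑ) ^ (2 : ℝ)
        = ‖k (x - y)‖ₑ * ‖f y‖ₑ ^ (2 : ℝ) := by
      intro y
      rw [ENNReal.mul_rpow_of_nonneg _ _ (by norm_num), e2]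
    have e4 : ∫⁻ y, ‖k (x - y)‖ₑ ∂ν = C :=
      lintegral_sub_left_eq_self (fun y => ‖k y‖ₑ) x
    simp only [e1, e2, e3, e4] at hCS
    calc _ ≤ (C ^ (1 / 2 : ℝ) * (∫⁻ y, ‖k (x - y)‖ₑ * ‖f y‖ₑ ^ (2 : ℝ) ∂ν) ^ (1 / 2 : ℝ))
          ^ (2 : ℝ) := ENNReal.rpow_le_rpow hCS (by norm_num)
      _ = _ := by
        rw [ENNReal.mul_rpow_of_nonneg _ _ (by norm_num), ← ENNReal.rpow_mul,
          ← ENNReal.rpow_mul]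
        norm_num
  have hmeas : AEMeasurable (fun p : X × X => ‖k (p.1 - p.2)‖ₑ * ‖f p.2‖ₑ ^ (2 : ℝ))
      (ν.prod ν) :=
    (hk.comp_quasiMeasurePreserving
      (quasiMeasurePreserving_sub_of_right_invariant ν ν)).enorm.mul
      (hf.comp_snd.enorm.pow_const _)
  calc _ ≤ ∫⁻ x, C * ∫⁻ y, ‖k (x - y)‖ₑ * ‖f y‖ₑ ^ (2 : ℝ) ∂ν ∂ν := lintegral_mono hpt
    _ = C * ∫⁻ x, ∫⁻ y, ‖k (x - y)‖ₑ * ‖f y‖ₑ ^ (2 : ℝ) ∂ν ∂ν :=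
        lintegral_const_mul'' _ hmeas.lintegral_prod_right'
    _ = C * ∫⁻ y, ∫⁻ x, ‖k (x - y)‖ₑ * ‖f y‖ₑ ^ (2 : ℝ) ∂ν ∂ν := by
        rw [lintegral_lintegral_swap hmeas]
    _ = C * ∫⁻ y, C * ‖f y‖ₑ ^ (2 : ℝ) ∂ν := by
        congr 1
        refine lintegral_congr fun y => ?_
        have hky : AEMeasurable (fun x => ‖k (x - y)‖ₑ) ν :=
          (hk.comp_quasiMeasurePreserving
            (measurePreserving_sub_right ν y).quasiMeasurePreserving).enorm
        rw [lintegral_mul_const'' _ hky, lintegral_sub_right_eq_self (fun x => ‖k x‖ₑ) y]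
    _ = _ := by
        rw [lintegral_const_mul'' _ (hf.enorm.pow_const _), ← mul_assoc]
        congr 1
        rw [show (2 : ℝ) = 1 + 1 by norm_num,
          ENNReal.rpow_add_of_nonneg _ _ (by norm_num) (by norm_num)]
        simp

theorem eLpNorm_conv_le {k : X → ℝ} (hk : Integrable k ν) {f : X → ℂ}
    (hf : AEStronglyMeasurable f ν) :
    eLpNorm (fun x => ∫ y, (k (x - y) : ℂ) * f y ∂ν) 2 ν
      ≤ (∫⁻ y, ‖k y‖ₑ ∂ν) * eLpNorm f 2 ν := by
  rw [eLpNorm_eq_lintegral_rpow_enorm_toReal (by norm_num) (by norm_num),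
    eLpNorm_eq_lintegral_rpow_enorm_toReal (by norm_num) (by norm_num)]
  simp only [ENNReal.toReal_ofNat]
  calc _ ≤ ((∫⁻ y, ‖k y‖ₑ ∂ν) ^ (2 : ℝ) * ∫⁻ y, ‖f y‖ₑ ^ (2 : ℝ) ∂ν) ^ (1 / 2 : ℝ) := by
        refine ENNReal.rpow_le_rpow (le_trans (lintegral_mono fun x => ?_)
          (lintegral_conv_sq_le hk.1 hf)) (by norm_num)
        exact ENNReal.rpow_le_rpow (enorm_integral_le_lintegral_enorm _) (by norm_num)
    _ = _ := by
        rw [ENNReal.mul_rpow_of_nonneg _ _ (by norm_num), ← ENNReal.rpow_mul]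
        norm_num

theorem memLp_conv {k : X → ℝ} (hk : Integrable k ν) {f : X → ℂ} (hf : MemLp f 2 ν) :
    MemLp (fun x => ∫ y, (k (x - y) : ℂ) * f y ∂ν) 2 ν :=
  ⟨(convKernel_aestronglyMeasurable hk.1 hf.1).integral_prod_right',
    (eLpNorm_conv_le hk hf.1).trans_lt (ENNReal.mul_lt_top hk.2 hf.2)⟩

theorem ae_integrable_conv {k : X → ℝ} (hk : Integrable k ν) {f : X → ℂ} (hf : MemLp f 2 ν) :
    ∀ᵐ x ∂ν, Integrable (fun y => (k (x - y) : ℂ) * f y) ν := by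
  have hm := convKernel_aestronglyMeasurable hk.1 hf.1
  have hfin : ∫⁻ x, (∫⁻ y, ‖(k (x - y) : ℂ) * f y‖ₑ ∂ν) ^ (2 : ℝ) ∂ν ≠ ∞ := by
    refine ((lintegral_conv_sq_le hk.1 hf.1).trans_lt (ENNReal.mul_lt_top ?_ ?_)).ne
    · exact ENNReal.rpow_lt_top_of_nonneg (by norm_num) hk.2.ne
    · have := lintegral_rpow_enorm_lt_top_of_eLpNorm_lt_top (by norm_num) (by norm_num) hf.2
      simpa using this
  have hae := ae_lt_top' (hm.enorm.lintegral_prod_right'.pow_const _) hfin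
  filter_upwards [hae, hm.prodMk_left] with x hx hx'
  refine ⟨hx', ?_⟩
  by_contra h
  have : ∫⁻ y, ‖(k (x - y) : ℂ) * f y‖ₑ ∂ν = ∞ := not_lt_top_iff.mp h
  rw [this] at hx
  simp at hx

/-- The integral operator on `L²(X, ν)` with the translation-invariant kernel
`(x, y) ↦ k (x - y)`, where `k` is integrable. -/
noncomputable def convOperator (k : X → ℝ) (hk : Integrable k ν) :
    Lp ℂ 2 ν →L[ℂ] Lp ℂ 2 ν :=
  LinearMap.mkContinuous
    { toFun := fun f => (memLp_conv hk (Lp.memLp f)).toLp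
        (fun x => ∫ y, (k (x - y) : ℂ) * f y ∂ν)
      map_add' := by
        intro f g
        rw [← MemLp.toLp_add, MemLp.toLp_eq_toLp_iff]
        filter_upwards [ae_integrable_conv hk (Lp.memLp f),
          ae_integrable_conv hk (Lp.memLp g)] with x hfx hgx
        rw [Pi.add_apply, ← integral_add hfx hgx]
        refine integral_congr_ae ?_
        filter_upwards [Lp.coeFn_add f g] with y hy
        rw [hy, Pi.add_apply, mul_add]
      map_smul' := by
        intro c f
        rw [RingHom.id_apply, ← MemLp.toLp_const_smul, MemLp.toLp_eq_toLp_iff]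
        refine Eventually.of_forall fun x => ?_
        rw [Pi.smul_apply, smul_eq_mul, ← integral_const_mul]
        refine integral_congr_ae ?_
        filter_upwards [Lp.coeFn_smul c f] with y hy
        rw [hy, Pi.smul_apply, smul_eq_mul]
        ring }
    (∫⁻ y, ‖k y‖ₑ ∂ν).toReal
    (fun f => by
      simp only [LinearMap.coe_mk, AddHom.coe_mk]
      rw [Lp.norm_toLp, Lp.norm_def, ← ENNReal.toReal_mul]
      exact ENNReal.toReal_mono (ENNReal.mul_lt_top hk.2 (Lp.memLp f).2).ne
        (eLpNorm_conv_le hk (Lp.memLp f).1))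

theorem convOperator_coeFn (k : X → ℝ) (hk : Integrable k ν) (f : Lp ℂ 2 ν) :
    convOperator k hk f =ᵐ[ν] fun x => ∫ y, (k (x - y) : ℂ) * f y ∂ν :=
  (memLp_conv hk (Lp.memLp f)).coeFn_toLp

/-- The projection on `L²(W, ν)` of the integral operator with kernel `(x, y) ↦ k (x - y)`:
extend by zero, apply the operator, restrict. The extension by zero `L²(W) → L²(X)` is the
adjoint of the restriction map `L²(X) → L²(W)`. -/
noncomputable def windowOperator (k : X → ℝ) (hk : Integrable k ν) (W : Set X) :
    Lp ℂ 2 (ν.restrict W) →L[ℂ] Lp ℂ 2 (ν.restrict W) :=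
  (LpToLpRestrictCLM X ℂ ℂ ν 2 W) ∘L convOperator k hk ∘L
    ContinuousLinearMap.adjoint (LpToLpRestrictCLM X ℂ ℂ ν 2 W)

end ConvolutionOperator

/-! ### Fredholm determinants of self-adjoint trace class operators -/

section FredholmDeterminant

variable {H : Type*} [NormedAddCommGroup H] [InnerProductSpace ℂ H]

/-- The multiplicity of the real number `μ` as an eigenvalue of `T`. -/
noncomputable def eigenMultiplicity (T : H →L[ℂ] H) (μ : ℝ) : ℕ :=
  Module.finrank ℂ (Module.End.eigenspace (T : H →ₗ[ℂ] H) (μ : ℂ))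

/-- `T` is self-adjoint, compact, and its eigenvalues, counted with multiplicity, are absolutely
summable. -/
def IsSelfAdjointTraceClass [CompleteSpace H] (T : H →L[ℂ] H) : Prop :=
  IsSelfAdjoint T ∧ IsCompactOperator T ∧
    Summable fun μ : ℝ => (eigenMultiplicity T μ : ℝ) * |μ|

/-- The Fredholm determinant `det(I - T) = ∏ᵢ (1 - λᵢ)` of a self-adjoint trace class operator `T`,
where `λᵢ` are the eigenvalues of `T` repeated according to multiplicity. The eigenvalue `0`, the
only one whose multiplicity can be infinite, contributes the factor `1`. -/
noncomputable def fredholmDet (T : H →L[ℂ] H) : ℝ :=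
  ∏' μ : ℝ, (1 - μ) ^ eigenMultiplicity T μ

end FredholmDeterminant

/-! ### Windows -/

/-- Regular growing windows in `X`, with respect to the measure `ν`, the distance `δ` and the
boundary operation `bdry`. -/
structure WindowCondition {X : Type*} [TopologicalSpace X] [MeasurableSpace X]
    (ν : Measure X) (δ : X → X → ℝ) (bdry : Set X → Set X) (W : ℕ → Set X) : Prop where
  monotone : Monotone W
  isCompact : ∀ n, IsCompact (W n)
  iUnion_eq : ⋃ n, W n = Set.univ
  boundary : ∃ r : ℕ → ℝ, (∀ n, 0 ≤ r n) ∧ Monotone r ∧ Tendsto r atTop atTop ∧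
    (fun n => ν.real ({x | ∃ y ∈ bdry (W n), δ x y ≤ r n} ∩ W n)) =o[atTop]
      (fun n => ν.real (W n))
  summable : ∀ c : ℝ, 0 < c → Summable fun n => Real.exp (-c * ν.real (W n))

/-! ### The lattice `ℤ^d` -/

/-- Euclidean distance on `ℤ^d`. -/
noncomputable def latticeDist {d : ℕ} (x y : Fin d → ℤ) : ℝ :=
  √(∑ i, ((x i : ℝ) - (y i : ℝ)) ^ 2)

/-- The boundary of a set of lattice points: its points with a nearest neighbour outside it. -/
def latticeBoundary {d : ℕ} (W : Set (Fin d → ℤ)) : Set (Fin d → ℤ) :=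
  {x | x ∈ W ∧ ∃ y, y ∉ W ∧ ∑ i, |x i - y i| = 1}

/-- The Fourier transform of a function on `ℤ^d`. -/
noncomputable def latticeFourier {d : ℕ} (f : (Fin d → ℤ) → ℝ) (x : Fin d → ℝ) : ℂ :=
  ∑' t : Fin d → ℤ, (f t : ℂ) *
    Complex.exp (-2 * Complex.I * (Real.pi : ℂ) * ((∑ i, (t i : ℝ) * x i : ℝ) : ℂ))

/-! ### Families of kernels -/

/-- The function `x ↦ sup_θ |K θ x|`, with values in `[0, ∞]`, is integrable. -/
def SupIntegrable {X Θ : Type*} [MeasurableSpace X] (ν : Measure X) (K : Θ → X → ℝ) : Prop :=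
  AEMeasurable (fun x => ⨆ θ, ENNReal.ofReal |K θ x|) ν ∧
    ∫⁻ x, ⨆ θ, ENNReal.ofReal |K θ x| ∂ν ≠ ∞

-- Let h be the Fourier transform of the kernel and v_x the character of frequency x restricted to
-- the window W. Then ‖v_x‖² = |W|, Bessel's inequality ∫ |⟨v_x, f⟩|² dx ≤ ‖f‖² holds, and the
-- window operator is T = ∫ h(x) |v_x⟩⟨v_x| dx in the weak sense. Hence its eigenvalues λ_i are
-- nonnegative and below 1, ∑ λ_i = |W| ∫ h exactly, and log det(I - T) = -|W| ∫ h - ∑ ψ(λ_i), where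
-- ψ(u) = -log(1 - u) - u is convex. It remains to compare ∑ ψ(λ_i) with |W| ∫ ψ(h), by a
-- Berezin–Lieb argument.
--
-- For an eigenbasis b_i, each λ_i is the integral of h against the weight |⟨v_x, b_i⟩|², of mass at
-- most one, so Jensen gives ∑ ψ(λ_i) ≤ |W| ∫ ψ(h) (`tsum_logRemainder_eigenvalue_le`). Conversely,
-- the tangent to ψ at h(x), evaluated at λ_i and integrated against the same weight, gives the
-- reverse inequality up to ∫ ψ'(h(x)) (⟨T v_x, v_x⟩ - |W| h(x)) dx
-- (`le_tsum_logRemainder_eigenvalue`).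
--
-- The diagonal ⟨T v_x, v_x⟩ differs from |W| h(x) by at most ∫ |K(u)| |{s ∈ W : s - u ∉ W}| du
-- (`enorm_inner_vec_sub_le`). Replacing |K| by its supremum over θ and dividing by |W_n| gives a
-- δ_n independent of θ, which tends to 0 by dominated convergence because the windows have small
-- boundary layers. As ψ'(h) = h/(1 - h) ≤ h/(1 - M) and ∫ h = K(0) ≤ C, the normalised error is at
-- most δ_n C/(1 - M), uniformly in θ (`uniform_szego`). The spaces ℝ^d and ℤ^d enter only through
-- Fourier inversion, Bessel's inequality and the fact that leaving W means crossing its boundary.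

universe u

/-! ### Hilbert–Schmidt operators, compactness and eigenbases. -/

section HilbertSpace

variable {H : Type*} [NormedAddCommGroup H] [InnerProductSpace ℂ H] {ι : Type*}

theorem HilbertBasis.hasSum_norm_inner_sq (b : HilbertBasis ι ℂ H) (f : H) :
    HasSum (fun i => ‖inner ℂ f (b i)‖ ^ 2) (‖f‖ ^ 2) := by
  have h := b.hasSum_inner_mul_inner f f
  have h2 := (Complex.hasSum_re h)
  convert h2 using 1
  · ext i
    rw [← inner_conj_symm (b i) f, Complex.mul_conj, Complex.ofReal_re, Complex.normSq_eq_norm_sq]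
  · rw [inner_self_eq_norm_sq_to_K]
    norm_cast

/-- Distinct basis vectors are √2 apart, so the balls of radius 1/2 around them are disjoint open
sets, and a separable space holds only countably many. Countability is what lets sums over the basis
be exchanged with integrals. -/
theorem HilbertBasis.countable_index [TopologicalSpace.SeparableSpace H]
    (b : HilbertBasis ι ℂ H) : Countable ι := by
  have hd : ∀ i j, i ≠ j → dist (b i) (b j) = √2 := by
    intro i j hij
    have h0 := b.orthonormal.2 hij
    have := @norm_sub_sq ℂ H _ _ _ (b i) (b j)
    rw [h0, b.orthonormal.1, b.orthonormal.1] at this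
    rw [dist_eq_norm, ← Real.sqrt_sq (norm_nonneg (b i - b j)), this]
    norm_num
  have hinj : Function.Injective b := b.orthonormal.linearIndependent.injective
  have : (Set.univ : Set ι).Countable := by
    refine Set.PairwiseDisjoint.countable_of_isOpen (s := fun i => Metric.ball (b i) (1/2))
      ?_ (fun i _ => Metric.isOpen_ball) (fun i _ => ⟨b i, by simp⟩)
    intro i _ j _ hij
    refine Metric.ball_disjoint_ball ?_
    rw [hd i j hij]
    norm_num
  exact Set.countable_univ_iff.mp this

variable [CompleteSpace H]

/-- A Hilbert–Schmidt operator is compact. -/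
theorem isCompactOperator_of_summable_norm_sq (b : HilbertBasis ι ℂ H) (S : H →L[ℂ] H)
    (hS : Summable fun i => ‖S (b i)‖ ^ 2) : IsCompactOperator S := by
  classical
  -- Finite-rank truncations of `S`. By Cauchy–Schwarz and Bessel they converge to `S` in operator
  -- norm, the error being at most the square root of a tail of `∑ ‖S (b i)‖ ^ 2`.
  let A : Finset ι → H →L[ℂ] H := fun F =>
    ∑ i ∈ F, (innerSL ℂ (b i)).smulRight (S (b i))
  have hA : ∀ F, IsCompactOperator (A F) := by
    intro F
    have h1 : ∀ i, (innerSL ℂ (b i)).smulRight (S (b i)) ∈ compactOperator (RingHom.id ℂ) H H := by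
      intro i
      have h2 : IsCompactOperator ((ContinuousLinearMap.id ℂ ℂ).smulRight (S (b i))) :=
        isCompactOperator_of_locallyCompactSpace_rng _
      exact h2.comp_clm (innerSL ℂ (b i))
    exact (compactOperator (RingHom.id ℂ) H H).sum_mem fun i _ => h1 i
  have hAf : ∀ F f, A F f = ∑ i ∈ F, inner ℂ (b i) f • S (b i) := by
    intro F f
    simp [A]
  refine isCompactOperator_of_tendsto (l := atTop) (F := A) ?_ (Eventually.of_forall hA)
  rw [Metric.tendsto_atTop]
  intro ε hε
  obtain ⟨F, hF⟩ := summable_iff_vanishing_norm.mp hS ((ε / 2) ^ 2) (by positivity)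
  refine ⟨F, fun G hG => ?_⟩
  rw [dist_eq_norm, norm_sub_rev]
  refine lt_of_le_of_lt ?_ (half_lt_self hε)
  refine ContinuousLinearMap.opNorm_le_bound _ (by positivity) fun f => ?_
  have hsum : HasSum (fun i => inner ℂ (b i) f • S (b i)) (S f) := by
    have := (b.hasSum_repr f).mapL S
    simpa [b.repr_apply_apply] using this
  have hlim : Tendsto (fun D => A D f - A G f) atTop (𝓝 (S f - A G f)) := by
    refine Tendsto.sub_const ?_ _
    simp only [hAf]
    exact hsum
  refine le_of_tendsto hlim.norm ?_
  filter_upwards [eventually_ge_atTop G] with D hD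
  rw [hAf, hAf, ← Finset.sum_sdiff hD, add_sub_cancel_right]
  calc ‖∑ i ∈ D \ G, inner ℂ (b i) f • S (b i)‖
      ≤ ∑ i ∈ D \ G, ‖inner ℂ (b i) f‖ * ‖S (b i)‖ :=
        (norm_sum_le _ _).trans (Finset.sum_le_sum fun i _ => norm_smul_le _ _)
    _ ≤ √(∑ i ∈ D \ G, ‖inner ℂ (b i) f‖ ^ 2) * √(∑ i ∈ D \ G, ‖S (b i)‖ ^ 2) :=
        Real.sum_mul_le_sqrt_mul_sqrt _ _ _
    _ ≤ ‖f‖ * (ε / 2) := by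
        gcongr
        · refine Real.sqrt_le_iff.mpr ⟨norm_nonneg _, b.orthonormal.sum_inner_products_le f⟩
        · refine Real.sqrt_le_iff.mpr ⟨by positivity, ?_⟩
          have := hF (D \ G) (Finset.disjoint_of_subset_right hG Finset.sdiff_disjoint)
          exact (le_abs_self _).trans this.le
    _ = ε / 2 * ‖f‖ := mul_comm _ _

/-- For the positive square root `S` of `T` one has `‖S (b i)‖² = ⟪T (b i), b i⟫`. A finite trace
thus makes `S` Hilbert–Schmidt, hence compact, and so is `T = S * S`. -/
theorem ContinuousLinearMap.IsPositive.isCompactOperator_of_summable (b : HilbertBasis ι ℂ H)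
    {T : H →L[ℂ] H} (hT : T.IsPositive)
    (hs : Summable fun i => (inner ℂ (T (b i)) (b i)).re) : IsCompactOperator T := by
  have h0 : (0 : H →L[ℂ] H) ≤ T := (ContinuousLinearMap.nonneg_iff_isPositive T).mpr hT
  set S := CFC.sqrt T with hSdef
  have hSS : S * S = T := CFC.sqrt_mul_sqrt_self T h0
  have hSpos : S.IsPositive :=
    (ContinuousLinearMap.nonneg_iff_isPositive S).mp (CFC.sqrt_nonneg T)
  have hcomp : IsCompactOperator S := by
    refine isCompactOperator_of_summable_norm_sq b S ?_
    convert hs using 1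
    ext i
    rw [← hSS, show (S * S) (b i) = S (S (b i)) from rfl, hSpos.inner_left_eq_inner_right,
      inner_self_eq_norm_sq_to_K]
    norm_cast
  rw [← hSS]
  exact hcomp.clm_comp S

/-- A compact self-adjoint operator has a Hilbert basis of eigenvectors, which can be grouped
according to the eigenvalue. -/
theorem exists_hilbertBasis_eigenvectors {H : Type u} [NormedAddCommGroup H]
    [InnerProductSpace ℂ H] [CompleteSpace H] {T : H →L[ℂ] H} (hc : IsCompactOperator T)
    (hT : T.IsSymmetric) :
    ∃ (w : ℝ → Type u) (b : HilbertBasis (Σ μ, w μ) ℂ H),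
      (∀ p : Σ μ, w μ, T (b p) = (p.1 : ℂ) • b p) ∧
      ∀ μ : ℝ, μ ≠ 0 → Finite (w μ) ∧ Nat.card (w μ) = eigenMultiplicity T μ := by
  let E : ℝ → Submodule ℂ H := fun μ => Module.End.eigenspace (T : H →ₗ[ℂ] H) (μ : ℂ)
  have hclosed : ∀ μ, IsClosed (E μ : Set H) := by
    intro μ
    have : (E μ : Set H) = {x | T x = (μ : ℂ) • x} := by
      ext x
      simp [E]
    rw [this]
    exact isClosed_eq T.continuous (continuous_const_smul _)
  have : ∀ μ, CompleteSpace (E μ) := fun μ => (hclosed μ).completeSpace_coe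
  choose w β hβ using fun μ => exists_hilbertBasis ℂ (E μ)
  have hfam : OrthogonalFamily ℂ (fun μ : ℝ => E μ) fun μ => (E μ).subtypeₗᵢ :=
    hT.orthogonalFamily_eigenspaces.comp Complex.ofReal_injective
  have hon : Orthonormal ℂ fun p : Σ μ, w μ => (E p.1).subtypeₗᵢ (β p.1 p.2) :=
    hfam.orthonormal_sigma_orthonormal fun μ => (β μ).orthonormal
  have hsp : (Submodule.span ℂ (Set.range
      fun p : Σ μ, w μ => (E p.1).subtypeₗᵢ (β p.1 p.2)))ᗮ = ⊥ := by
    rw [eq_bot_iff, ← ContinuousLinearMap.orthogonalComplement_iSup_eigenspaces_eq_bot hc hT]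
    intro x hx
    rw [Submodule.mem_orthogonal] at hx
    rw [← Submodule.iInf_orthogonal, Submodule.mem_iInf]
    intro z
    rw [Submodule.mem_orthogonal]
    intro u hu
    by_cases hu0 : u = 0
    · simp [hu0]
    -- A symmetric operator has only real eigenvalues, so the eigenspaces indexed by ℝ are all of
    -- the nonzero ones.
    have hz := hT.conj_eigenvalue_eq_self (Module.End.hasEigenvalue_of_hasEigenvector ⟨hu, hu0⟩)
    obtain ⟨μ, rfl⟩ := Complex.conj_eq_iff_real.mp hz
    have hsum := ((β μ).hasSum_repr ⟨u, hu⟩).mapL (E μ).subtypeL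
    have h2 := hsum.mapL (innerSL ℂ x)
    have h3 : ∀ i, (innerSL ℂ x) ((E μ).subtypeL (((β μ).repr ⟨u, hu⟩ i) • (β μ) i)) = 0 := by
      intro i
      have := hx _ (Submodule.subset_span ⟨⟨μ, i⟩, rfl⟩)
      have h4 := inner_eq_zero_symm.mp this
      simp only [map_smul, innerSL_apply_apply]
      rw [show (E μ).subtypeL ((β μ) i) = (E μ).subtypeₗᵢ ((β μ) i) from rfl, h4, smul_zero]
    simp only [h3] at h2
    have h5 := h2.unique hasSum_zero
    exact inner_eq_zero_symm.mp h5
  refine ⟨fun μ => w μ, HilbertBasis.mkOfOrthogonalEqBot hon hsp, ?_, ?_⟩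
  · rintro ⟨μ, i⟩
    rw [HilbertBasis.coe_mkOfOrthogonalEqBot]
    exact Module.End.mem_eigenspace_iff.mp (β μ i).2
  · intro μ hμ
    have : FiniteDimensional ℂ (E μ) :=
      ContinuousLinearMap.finite_dimensional_eigenspace hc (μ : ℂ) (by exact_mod_cast hμ)
    have hli := (β μ).orthonormal.linearIndependent
    have : Finite (w μ) := hli.finite
    refine ⟨this, ?_⟩
    have := Fintype.ofFinite (w μ)
    rw [Nat.card_eq_fintype_card, eigenMultiplicity]
    exact (Module.finrank_eq_card_basis (β μ).toOrthonormalBasis.toBasis).symm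

end HilbertSpace

/-! ### Passing from sums over an eigenbasis to multiplicities and the determinant. -/

section EigenvalueSums

variable {H : Type*} [NormedAddCommGroup H] [InnerProductSpace ℂ H]
  {T : H →L[ℂ] H} {w : ℝ → Type*}

/-- Group the basis vectors by eigenvalue. The kernel of `T` may be infinite-dimensional, where
`finrank` takes the default value 0; the condition `f 0 = 0` makes this harmless. -/
theorem hasSum_eigenMultiplicity_mul
    (hw : ∀ μ : ℝ, μ ≠ 0 → Finite (w μ) ∧ Nat.card (w μ) = eigenMultiplicity T μ)
    {f : ℝ → ℝ} (hf : f 0 = 0) {S : ℝ} (hS : HasSum (fun p : Σ μ, w μ => f p.1) S) :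
    HasSum (fun μ => (eigenMultiplicity T μ : ℝ) * f μ) S := by
  refine hS.sigma fun μ => ?_
  by_cases hμ : μ = 0
  · subst hμ
    simp only [hf, mul_zero]
    exact hasSum_zero
  · obtain ⟨h1, h2⟩ := hw μ hμ
    have := Fintype.ofFinite (w μ)
    convert hasSum_fintype (fun _ : w μ => f μ) using 1
    rw [Finset.sum_const, Finset.card_univ, ← Nat.card_eq_fintype_card, h2, nsmul_eq_mul]

theorem fredholmDet_eq_exp
    (hw : ∀ μ : ℝ, μ ≠ 0 → Finite (w μ) ∧ Nat.card (w μ) = eigenMultiplicity T μ)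
    (hlt : ∀ p : Σ μ, w μ, p.1 < 1) {S : ℝ}
    (hS : HasSum (fun p : Σ μ, w μ => Real.log (1 - p.1)) S) :
    fredholmDet T = Real.exp S := by
  have h := hasSum_eigenMultiplicity_mul hw (f := fun μ => Real.log (1 - μ)) (by simp) hS
  rw [fredholmDet, ← h.rexp.tprod_eq]
  congr 1
  ext μ
  simp only [Function.comp]
  by_cases hμ : μ = 0
  · simp [hμ]
  · obtain ⟨h1, h2⟩ := hw μ hμ
    -- If `μ` is not an eigenvalue the exponent is 0, so the junk value of `Real.log` for `1 ≤ μ`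
    -- does not matter.
    rcases isEmpty_or_nonempty (w μ) with he | ⟨⟨i⟩⟩
    · rw [← h2]; simp
    · have : μ < 1 := hlt ⟨μ, i⟩
      rw [Real.exp_nat_mul, Real.exp_log (by linarith)]

end EigenvalueSums

/-! ### The convex function behind the determinant. -/

/-- The convex function `u ↦ -log (1 - u) - u`. -/
noncomputable def logRemainder (u : ℝ) : ℝ := -Real.log (1 - u) - u

/-- This is `log t ≥ 1 - 1/t` at `t = (1 - b) / (1 - a)`. Removing the linear term `u` from `-log (1
- u)` makes the slope `b / (1 - b)` vanish at 0, so that the slope at `h x` is integrable even when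
the frequency space has infinite measure. -/
theorem logRemainder_tangent {a b : ℝ} (ha : a < 1) (hb : b < 1) :
    logRemainder b + b / (1 - b) * (a - b) ≤ logRemainder a := by
  have ha' : 0 < 1 - a := by linarith
  have hb' : 0 < 1 - b := by linarith
  have h := Real.one_sub_inv_le_log_of_pos (div_pos hb' ha')
  rw [Real.log_div hb'.ne' ha'.ne', inv_div] at h
  have e : b / (1 - b) * (a - b) = 1 - (1 - a) / (1 - b) - (a - b) := by
    field_simp
    ring
  rw [e]
  unfold logRemainder
  linarith

theorem logRemainder_nonneg {a : ℝ} (ha : a < 1) : 0 ≤ logRemainder a := by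
  have := logRemainder_tangent ha zero_lt_one
  simpa [logRemainder] using this

/-- The tangent at `a`, evaluated at 0, lies below the value 0 of the function there. -/
theorem logRemainder_le {a : ℝ} (ha : a < 1) : logRemainder a ≤ a / (1 - a) * a := by
  have := logRemainder_tangent zero_lt_one ha
  simp only [logRemainder, sub_zero, Real.log_one, neg_zero] at this ⊢
  linarith

@[fun_prop]
theorem measurable_logRemainder : Measurable logRemainder := by
  unfold logRemainder
  fun_prop

/-! ### Frame operators: trace formula and Berezin–Lieb inequalities. -/

/-- `T = ∫ h x |v x⟩⟨v x| dμ` in the weak sense, where the vectors `v x` all have squared norm `V`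
and satisfy a Bessel inequality. -/
structure IsFrameOperator {H : Type*} [NormedAddCommGroup H] [InnerProductSpace ℂ H]
    {Y : Type*} [MeasurableSpace Y] (μ : Measure Y) (v : Y → H) (h : Y → ℝ) (V M : ℝ)
    (T : H →L[ℂ] H) : Prop where
  bound_nonneg : 0 ≤ M
  lt_one : M < 1
  measurable_inner : ∀ f, AEStronglyMeasurable (fun x => inner ℂ (v x) f) μ
  norm_sq : ∀ x, ‖v x‖ ^ 2 = V
  integrable : Integrable h μ
  nonneg : ∀ᵐ x ∂μ, 0 ≤ h x
  le : ∀ᵐ x ∂μ, h x ≤ M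
  bessel : ∀ f, Integrable (fun x => ‖inner ℂ (v x) f‖ ^ 2) μ ∧
    ∫ x, ‖inner ℂ (v x) f‖ ^ 2 ∂μ ≤ ‖f‖ ^ 2
  inner_eq : ∀ f, inner ℂ (T f) f = ((∫ x, h x * ‖inner ℂ (v x) f‖ ^ 2 ∂μ : ℝ) : ℂ)

namespace IsFrameOperator

variable {H : Type*} [NormedAddCommGroup H] [InnerProductSpace ℂ H]
  {Y : Type*} [MeasurableSpace Y] {μ : Measure Y} {v : Y → H} {h : Y → ℝ} {V M : ℝ}
  {T : H →L[ℂ] H} {ι : Type*}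

theorem norm_inner_sq_le (hF : IsFrameOperator μ v h V M T) (b : HilbertBasis ι ℂ H) (x : Y)
    (i : ι) : ‖inner ℂ (v x) (b i)‖ ^ 2 ≤ V := by
  rw [← hF.norm_sq x]
  have := norm_inner_le_norm (𝕜 := ℂ) (v x) (b i)
  rw [b.orthonormal.1, mul_one] at this
  gcongr

theorem integrable_mul_weight (hF : IsFrameOperator μ v h V M T) (b : HilbertBasis ι ℂ H)
    {g : Y → ℝ} (hg : Integrable g μ) (i : ι) :
    Integrable (fun x => g x * ‖inner ℂ (v x) (b i)‖ ^ 2) μ := by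
  refine hg.mul_bdd (c := V) ((hF.measurable_inner (b i)).norm.pow 2) ?_
  refine Eventually.of_forall fun x => ?_
  rw [Real.norm_of_nonneg (by positivity)]
  exact hF.norm_inner_sq_le b x i

/-- Parseval gives `∑ ‖⟪v x, b i⟫‖² = V` for every `x`; integrate against `g`, the exchange being
justified by positivity. With `g = h` this is the trace formula. -/
theorem hasSum_integral_mul_weight (hF : IsFrameOperator μ v h V M T) [Countable ι]
    (b : HilbertBasis ι ℂ H) {g : Y → ℝ} (hg : Integrable g μ) (hg0 : ∀ᵐ x ∂μ, 0 ≤ g x) :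
    HasSum (fun i => ∫ x, g x * ‖inner ℂ (v x) (b i)‖ ^ 2 ∂μ) (V * ∫ x, g x ∂μ) := by
  have hs : ∀ x, HasSum (fun i => g x * ‖inner ℂ (v x) (b i)‖ ^ 2) (g x * V) := by
    intro x
    rw [← hF.norm_sq x]
    exact (b.hasSum_norm_inner_sq (v x)).mul_left _
  have hint := hF.integrable_mul_weight b hg
  have hnn : ∀ᵐ x ∂μ, ∀ i, 0 ≤ g x * ‖inner ℂ (v x) (b i)‖ ^ 2 := by
    filter_upwards [hg0] with x hx i
    positivity
  have hnn' : ∀ i, 0 ≤ ∫ x, g x * ‖inner ℂ (v x) (b i)‖ ^ 2 ∂μ := fun i =>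
    integral_nonneg_of_ae (by filter_upwards [hnn] with x hx using hx i)
  have hsum : Summable fun i => ∫ x, g x * ‖inner ℂ (v x) (b i)‖ ^ 2 ∂μ := by
    refine summable_of_sum_le (c := ∫ x, g x * V ∂μ) hnn' fun F => ?_
    rw [← integral_finsetSum _ fun i _ => hint i]
    refine integral_mono_ae (integrable_finsetSum _ fun i _ => hint i) (hg.mul_const V) ?_
    filter_upwards [hnn] with x hx
    exact sum_le_hasSum F (fun i _ => hx i) (hs x)
  have := hasSum_integral_of_summable_integral_norm hint (by
    convert hsum using 1
    ext i
    refine integral_congr_ae ?_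
    filter_upwards [hnn] with x hx
    exact Real.norm_of_nonneg (hx i))
  have e : V * ∫ x, g x ∂μ = ∫ x, ∑' i, g x * ‖inner ℂ (v x) (b i)‖ ^ 2 ∂μ := by
    rw [← integral_const_mul]
    congr 1
    ext x
    rw [(hs x).tsum_eq, mul_comm]
  rw [e]
  exact this

theorem isPositive (hF : IsFrameOperator μ v h V M T) : T.IsPositive := by
  rw [ContinuousLinearMap.isPositive_iff_complex]
  intro f
  rw [hF.inner_eq f]
  refine ⟨by simp, ?_⟩
  simp only [RCLike.re_to_complex, Complex.ofReal_re]
  refine integral_nonneg_of_ae ?_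
  filter_upwards [hF.nonneg] with x hx
  simp only [Pi.zero_apply]
  positivity

theorem hasSum_trace (hF : IsFrameOperator μ v h V M T) [Countable ι] (b : HilbertBasis ι ℂ H) :
    HasSum (fun i => (inner ℂ (T (b i)) (b i)).re) (V * ∫ x, h x ∂μ) := by
  simp only [hF.inner_eq, Complex.ofReal_re]
  exact hF.hasSum_integral_mul_weight b hF.integrable hF.nonneg

theorem isCompactOperator [CompleteSpace H] [TopologicalSpace.SeparableSpace H]
    (hF : IsFrameOperator μ v h V M T) : IsCompactOperator T := by
  obtain ⟨s, b, -⟩ := exists_hilbertBasis ℂ H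
  have := b.countable_index
  exact hF.isPositive.isCompactOperator_of_summable b (hF.hasSum_trace b).summable

section Eigenbasis

variable {l : ι → ℝ} (b : HilbertBasis ι ℂ H)

/-- This presents an eigenvalue as an integral of `h` against a weight which, by Bessel, has mass at
most 1: the setting for Jensen's inequality. -/
theorem eigenvalue_eq_integral (hF : IsFrameOperator μ v h V M T)
    (hb : ∀ i, T (b i) = (l i : ℂ) • b i) (i : ι) :
    l i = ∫ x, h x * ‖inner ℂ (v x) (b i)‖ ^ 2 ∂μ := by
  have := hF.inner_eq (b i)
  rw [hb, inner_smul_left, inner_self_eq_norm_sq_to_K, b.orthonormal.1] at this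
  simp only [Complex.conj_ofReal] at this
  exact_mod_cast (by simpa using this)

theorem eigenvalue_nonneg (hF : IsFrameOperator μ v h V M T)
    (hb : ∀ i, T (b i) = (l i : ℂ) • b i) (i : ι) : 0 ≤ l i := by
  rw [hF.eigenvalue_eq_integral b hb i]
  refine integral_nonneg_of_ae ?_
  filter_upwards [hF.nonneg] with x hx
  simp only [Pi.zero_apply]
  positivity

theorem eigenvalue_lt_one (hF : IsFrameOperator μ v h V M T)
    (hb : ∀ i, T (b i) = (l i : ℂ) • b i) (i : ι) : l i < 1 := by
  refine lt_of_le_of_lt ?_ hF.lt_one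
  calc l i = ∫ x, h x * ‖inner ℂ (v x) (b i)‖ ^ 2 ∂μ := hF.eigenvalue_eq_integral b hb i
    _ ≤ ∫ x, M * ‖inner ℂ (v x) (b i)‖ ^ 2 ∂μ := by
        refine integral_mono_ae (hF.integrable_mul_weight b hF.integrable i)
          ((hF.bessel (b i)).1.const_mul M) ?_
        filter_upwards [hF.le] with x hx
        gcongr
    _ ≤ M * 1 := by
        rw [integral_const_mul]
        have := (hF.bessel (b i)).2
        rw [b.orthonormal.1, one_pow] at this
        exact mul_le_mul_of_nonneg_left this hF.bound_nonneg
    _ = M := mul_one M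

theorem hasSum_eigenvalue [Countable ι] (hF : IsFrameOperator μ v h V M T)
    (hb : ∀ i, T (b i) = (l i : ℂ) • b i) : HasSum l (V * ∫ x, h x ∂μ) := by
  convert hF.hasSum_integral_mul_weight b hF.integrable hF.nonneg using 1
  ext i
  exact hF.eigenvalue_eq_integral b hb i

theorem integrable_div_one_sub (hF : IsFrameOperator μ v h V M T) :
    Integrable (fun x => h x / (1 - h x)) μ := by
  refine (hF.integrable.div_const (1 - M)).mono'
    (hF.integrable.1.aemeasurable.div
      (aemeasurable_const.sub hF.integrable.1.aemeasurable)).aestronglyMeasurable ?_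
  filter_upwards [hF.nonneg, hF.le] with x h0 h1
  have h2 := hF.lt_one
  rw [Real.norm_of_nonneg (div_nonneg h0 (by linarith))]
  gcongr

theorem integrable_logRemainder (hF : IsFrameOperator μ v h V M T) :
    Integrable (fun x => logRemainder (h x)) μ := by
  refine hF.integrable_div_one_sub.mono'
    (measurable_logRemainder.comp_aemeasurable hF.integrable.1.aemeasurable).aestronglyMeasurable ?_
  filter_upwards [hF.nonneg, hF.le] with x h0 h1
  have h2 := hF.lt_one
  rw [Real.norm_of_nonneg (logRemainder_nonneg (by linarith))]
  refine (logRemainder_le (by linarith)).trans ?_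
  exact mul_le_of_le_one_right (div_nonneg h0 (by linarith)) (by linarith)

/-- Half of the Berezin–Lieb inequality, for a single eigenvector. -/
theorem logRemainder_eigenvalue_le (hF : IsFrameOperator μ v h V M T)
    (hb : ∀ i, T (b i) = (l i : ℂ) • b i) (i : ι) :
    logRemainder (l i) ≤ ∫ x, logRemainder (h x) * ‖inner ℂ (v x) (b i)‖ ^ 2 ∂μ := by
  have hl0 := hF.eigenvalue_nonneg b hb i
  have hl1 := hF.eigenvalue_lt_one b hb i
  set q := l i / (1 - l i) with hq
  have hq0 : 0 ≤ q := div_nonneg hl0 (by linarith)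
  have hmass := (hF.bessel (b i)).2
  rw [b.orthonormal.1, one_pow] at hmass
  -- The tangent at `l i` has a nonpositive intercept, so Jensen's inequality survives a weight of
  -- mass less than 1.
  have hneg : logRemainder (l i) - q * l i ≤ 0 := sub_nonpos.mpr (logRemainder_le hl1)
  calc logRemainder (l i) = (logRemainder (l i) - q * l i) * 1 + q * l i := by ring
    _ ≤ (logRemainder (l i) - q * l i) * ∫ x, ‖inner ℂ (v x) (b i)‖ ^ 2 ∂μ + q * l i := by
        have := mul_le_mul_of_nonpos_left hmass hneg
        linarith
    _ = ∫ x, ((logRemainder (l i) - q * l i) * ‖inner ℂ (v x) (b i)‖ ^ 2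
          + q * (h x * ‖inner ℂ (v x) (b i)‖ ^ 2)) ∂μ := by
        rw [integral_add ((hF.bessel (b i)).1.const_mul _)
          ((hF.integrable_mul_weight b hF.integrable i).const_mul _), integral_const_mul,
          integral_const_mul, ← hF.eigenvalue_eq_integral b hb i]
    _ ≤ _ := by
        refine integral_mono_ae (((hF.bessel (b i)).1.const_mul _).add
          ((hF.integrable_mul_weight b hF.integrable i).const_mul _))
          (hF.integrable_mul_weight b hF.integrable_logRemainder i) ?_
        filter_upwards [hF.nonneg, hF.le] with x h0 h1
        have h2 := hF.lt_one
        have ht := logRemainder_tangent (show h x < 1 by linarith) hl1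
        have := mul_le_mul_of_nonneg_right ht (sq_nonneg ‖inner ℂ (v x) (b i)‖)
        simp only [hq]
        linarith

theorem summable_logRemainder_eigenvalue [Countable ι] (hF : IsFrameOperator μ v h V M T)
    (hb : ∀ i, T (b i) = (l i : ℂ) • b i) : Summable fun i => logRemainder (l i) := by
  refine Summable.of_nonneg_of_le (fun i => logRemainder_nonneg (hF.eigenvalue_lt_one b hb i))
    (hF.logRemainder_eigenvalue_le b hb)
    (hF.hasSum_integral_mul_weight b hF.integrable_logRemainder ?_).summable
  filter_upwards [hF.le] with x h1
  exact logRemainder_nonneg (h1.trans_lt hF.lt_one)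

theorem tsum_logRemainder_eigenvalue_le [Countable ι] (hF : IsFrameOperator μ v h V M T)
    (hb : ∀ i, T (b i) = (l i : ℂ) • b i) :
    ∑' i, logRemainder (l i) ≤ V * ∫ x, logRemainder (h x) ∂μ := by
  refine hasSum_le (hF.logRemainder_eigenvalue_le b hb)
    (hF.summable_logRemainder_eigenvalue b hb).hasSum
    (hF.hasSum_integral_mul_weight b hF.integrable_logRemainder ?_)
  filter_upwards [hF.le] with x h1
  exact logRemainder_nonneg (h1.trans_lt hF.lt_one)

theorem hasSum_inner_apply_self (b : HilbertBasis ι ℂ H) (hT : T.IsPositive)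
    (hb : ∀ i, T (b i) = (l i : ℂ) • b i) (u : H) :
    HasSum (fun i => l i * ‖inner ℂ u (b i)‖ ^ 2) (inner ℂ (T u) u).re := by
  convert Complex.hasSum_re (b.hasSum_inner_mul_inner (T u) u) using 1
  ext i
  rw [hT.inner_left_eq_inner_right, hb, inner_smul_right, mul_assoc, ← inner_conj_symm (b i) u,
    Complex.mul_conj, ← Complex.ofReal_mul, Complex.ofReal_re, Complex.normSq_eq_norm_sq]

/-- The reverse Berezin–Lieb inequality, up to the deviation of `⟪T (v x), v x⟫` from `V * h x`. -/
theorem le_tsum_logRemainder_eigenvalue [Countable ι] (hF : IsFrameOperator μ v h V M T)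
    (hb : ∀ i, T (b i) = (l i : ℂ) • b i) {ε : ℝ}
    (hε : ∀ᵐ x ∂μ, |(inner ℂ (T (v x)) (v x)).re - V * h x| ≤ V * ε) :
    V * ∫ x, logRemainder (h x) ∂μ - V * ε * ∫ x, h x / (1 - h x) ∂μ
      ≤ ∑' i, logRemainder (l i) := by
  have hq := hF.integrable_div_one_sub
  have hq0 : ∀ᵐ x ∂μ, 0 ≤ h x / (1 - h x) := by
    filter_upwards [hF.nonneg, hF.le] with x h0 h1
    have := hF.lt_one
    exact div_nonneg h0 (by linarith)
  have hqh : Integrable (fun x => h x / (1 - h x) * h x) μ := by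
    refine hq.mul_bdd (c := M) hF.integrable.1 ?_
    filter_upwards [hF.nonneg, hF.le] with x h0 h1
    rwa [Real.norm_of_nonneg h0]
  have hqh0 : ∀ᵐ x ∂μ, 0 ≤ h x / (1 - h x) * h x := by
    filter_upwards [hF.nonneg, hq0] with x h0 h1
    positivity
  have hψ0 : ∀ᵐ x ∂μ, 0 ≤ logRemainder (h x) := by
    filter_upwards [hF.le] with x h1
    exact logRemainder_nonneg (h1.trans_lt hF.lt_one)
  have s1 := hF.hasSum_integral_mul_weight b hF.integrable_logRemainder hψ0
  have s2 := hF.hasSum_integral_mul_weight b hqh hqh0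
  have hdiag := hasSum_inner_apply_self b hF.isPositive hb
  have hl0 := hF.eigenvalue_nonneg b hb
  have hint : ∀ i, Integrable
      (fun x => l i * (h x / (1 - h x) * ‖inner ℂ (v x) (b i)‖ ^ 2)) μ := fun i =>
    (hF.integrable_mul_weight b hq i).const_mul _
  -- Summing the eigenvalues against the weights at a fixed `x` reconstitutes the diagonal `⟪T (v
  -- x), v x⟫`, which is how the deviation in `hε` enters.
  have htsum : ∀ x, ∑' i, l i * (h x / (1 - h x) * ‖inner ℂ (v x) (b i)‖ ^ 2)
      = h x / (1 - h x) * (inner ℂ (T (v x)) (v x)).re := by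
    intro x
    rw [← ((hdiag (v x)).mul_left (h x / (1 - h x))).tsum_eq]
    congr 1
    ext i
    ring
  have s3 : HasSum (fun i => ∫ x, l i * (h x / (1 - h x) * ‖inner ℂ (v x) (b i)‖ ^ 2) ∂μ)
      (∫ x, h x / (1 - h x) * (inner ℂ (T (v x)) (v x)).re ∂μ) := by
    simp only [← htsum]
    refine hasSum_integral_of_summable_integral_norm hint ?_
    refine Summable.of_nonneg_of_le (fun i => integral_nonneg fun x => norm_nonneg _) (fun i => ?_)
      ((hF.hasSum_eigenvalue b hb).summable.mul_right (V * ∫ x, h x / (1 - h x) ∂μ))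
    have e : ∫ x, ‖l i * (h x / (1 - h x) * ‖inner ℂ (v x) (b i)‖ ^ 2)‖ ∂μ
        = l i * ∫ x, h x / (1 - h x) * ‖inner ℂ (v x) (b i)‖ ^ 2 ∂μ := by
      rw [← integral_const_mul]
      refine integral_congr_ae ?_
      filter_upwards [hq0] with x hx
      exact Real.norm_of_nonneg (mul_nonneg (hl0 i) (by positivity))
    rw [e, ← integral_const_mul V]
    refine mul_le_mul_of_nonneg_left ?_ (hl0 i)
    refine integral_mono_ae (hF.integrable_mul_weight b hq i) (hq.const_mul V) ?_
    filter_upwards [hq0] with x hx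
    rw [mul_comm]
    exact mul_le_mul_of_nonneg_right (hF.norm_inner_sq_le b x i) hx
  -- The tangent at `h x`, evaluated at `l i`, is integrated against the weight. Mass at most 1
  -- suffices because `logRemainder (l i)` is nonnegative.
  have hterm : ∀ i, (∫ x, logRemainder (h x) * ‖inner ℂ (v x) (b i)‖ ^ 2 ∂μ)
      + (∫ x, l i * (h x / (1 - h x) * ‖inner ℂ (v x) (b i)‖ ^ 2) ∂μ)
      - (∫ x, h x / (1 - h x) * h x * ‖inner ℂ (v x) (b i)‖ ^ 2 ∂μ) ≤ logRemainder (l i) := by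
    intro i
    have hmass := (hF.bessel (b i)).2
    rw [b.orthonormal.1, one_pow] at hmass
    have i1 := hF.integrable_mul_weight b hF.integrable_logRemainder i
    have i2 := hF.integrable_mul_weight b hqh i
    have hψ := logRemainder_nonneg (hF.eigenvalue_lt_one b hb i)
    rw [← integral_add i1 (hint i), ← integral_sub (by exact i1.add (hint i)) i2]
    calc _ ≤ ∫ x, logRemainder (l i) * ‖inner ℂ (v x) (b i)‖ ^ 2 ∂μ := by
          refine integral_mono_ae ((i1.add (hint i)).sub i2) ((hF.bessel (b i)).1.const_mul _) ?_
          filter_upwards [hF.le] with x h1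
          have ht := logRemainder_tangent (hF.eigenvalue_lt_one b hb i)
            (h1.trans_lt hF.lt_one)
          have := mul_le_mul_of_nonneg_right ht (sq_nonneg ‖inner ℂ (v x) (b i)‖)
          linarith
      _ ≤ logRemainder (l i) := by
          rw [integral_const_mul]
          exact mul_le_of_le_one_right hψ hmass
  have hle := hasSum_le hterm ((s1.add s3).sub s2)
    (hF.summable_logRemainder_eigenvalue b hb).hasSum
  refine le_trans ?_ hle
  -- Only the scalar products with fixed vectors are known to be measurable in `x`, so the diagonal
  -- is treated as a limit of finite eigen-expansions.
  have hmeas : AEStronglyMeasurable (fun x => (inner ℂ (T (v x)) (v x)).re) μ := by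
    refine aestronglyMeasurable_of_tendsto_ae (u := (atTop : Filter (Finset ι)))
      (f := fun F x => ∑ i ∈ F, l i * ‖inner ℂ (v x) (b i)‖ ^ 2) (fun F => ?_)
      (Eventually.of_forall fun x => hdiag (v x))
    refine Finset.aestronglyMeasurable_fun_sum F fun i _ => ?_
    exact ((hF.measurable_inner (b i)).norm.pow 2).const_mul _
  have iT : Integrable (fun x => h x / (1 - h x) * (inner ℂ (T (v x)) (v x)).re) μ := by
    refine hq.mul_bdd (c := |V| * M + V * ε) hmeas ?_
    filter_upwards [hF.nonneg, hF.le, hε] with x h0 h1 h2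
    have h3 : |V * h x| ≤ |V| * M := by
      rw [abs_mul, abs_of_nonneg h0]
      gcongr
    rw [Real.norm_eq_abs]
    have := abs_sub_abs_le_abs_sub (inner ℂ (T (v x)) (v x)).re (V * h x)
    linarith
  have hfin : V * (∫ x, h x / (1 - h x) * h x ∂μ) - V * ε * ∫ x, h x / (1 - h x) ∂μ
      ≤ ∫ x, h x / (1 - h x) * (inner ℂ (T (v x)) (v x)).re ∂μ := by
    rw [← integral_const_mul, ← integral_const_mul,
      ← integral_sub (hqh.const_mul _) (hq.const_mul _)]
    refine integral_mono_ae ((hqh.const_mul _).sub (hq.const_mul _)) iT ?_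
    filter_upwards [hq0, hε] with x h0 h2
    have := (abs_le.mp h2).1
    have := mul_le_mul_of_nonneg_left this h0
    linarith
  linarith

end Eigenbasis

theorem log_one_sub_eq (u : ℝ) : Real.log (1 - u) = -(u + logRemainder u) := by
  unfold logRemainder
  ring

theorem integrable_log (hF : IsFrameOperator μ v h V M T) :
    Integrable (fun x => Real.log (1 - h x)) μ := by
  simp only [log_one_sub_eq]
  exact (hF.integrable.add hF.integrable_logRemainder).neg

/-- A frame operator is trace class, its Fredholm determinant is positive, and the logarithm of
the determinant is close to `V * ∫ log (1 - h)` if `⟪T (v x), v x⟫` is close to `V * h x`. -/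
theorem traceClass_and_det [CompleteSpace H] [TopologicalSpace.SeparableSpace H]
    (hF : IsFrameOperator μ v h V M T) :
    IsSelfAdjointTraceClass T ∧ 0 < fredholmDet T ∧
    ∀ ε, (∀ᵐ x ∂μ, |(inner ℂ (T (v x)) (v x)).re - V * h x| ≤ V * ε) →
      |Real.log (fredholmDet T) - V * ∫ x, Real.log (1 - h x) ∂μ|
        ≤ V * ε * ∫ x, h x / (1 - h x) ∂μ := by
  obtain ⟨w, b, hb, hw⟩ := exists_hilbertBasis_eigenvectors hF.isCompactOperator
    hF.isPositive.isSymmetric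
  have := b.countable_index
  have hsum := hF.hasSum_eigenvalue b (l := fun p => p.1) hb
  have hrem := (hF.summable_logRemainder_eigenvalue b (l := fun p => p.1) hb).hasSum
  have hlog : HasSum (fun p : Σ μ, w μ => Real.log (1 - p.1))
      (-(V * ∫ x, h x ∂μ + ∑' p : Σ μ, w μ, logRemainder p.1)) := by
    simp only [log_one_sub_eq]
    exact (hsum.add hrem).neg
  have hdet := fredholmDet_eq_exp hw (hF.eigenvalue_lt_one b (l := fun p => p.1) hb) hlog
  refine ⟨⟨hF.isPositive.isSelfAdjoint, hF.isCompactOperator, ?_⟩, ?_, ?_⟩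
  · exact (hasSum_eigenMultiplicity_mul hw abs_zero hsum.summable.abs.hasSum).summable
  · rw [hdet]
    exact Real.exp_pos _
  · intro ε hε
    have h1 := hF.tsum_logRemainder_eigenvalue_le b (l := fun p => p.1) hb
    have h2 := hF.le_tsum_logRemainder_eigenvalue b (l := fun p => p.1) hb hε
    rw [hdet, Real.log_exp]
    -- The two trace terms `V * ∫ h` cancel; by `h1` and `h2` the remaining difference lies between
    -- 0 and the error term.
    simp only [log_one_sub_eq]
    rw [integral_neg, integral_add hF.integrable hF.integrable_logRemainder, abs_le]
    constructor <;> nlinarith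
end IsFrameOperator

/-! ### The quadratic form of a window operator. -/

section WindowOperator

theorem adjoint_restrict_coeFn {X : Type*} [MeasurableSpace X] {ν : Measure X} {W : Set X}
    (hW : MeasurableSet W) (f : Lp ℂ 2 (ν.restrict W)) :
    ContinuousLinearMap.adjoint (LpToLpRestrictCLM X ℂ ℂ ν 2 W) f =ᵐ[ν] W.indicator f := by
  have hmem : MemLp (W.indicator f) 2 ν := (memLp_indicator_iff_restrict hW).mpr (Lp.memLp f)
  have : ContinuousLinearMap.adjoint (LpToLpRestrictCLM X ℂ ℂ ν 2 W) f = hmem.toLp _ := by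
    refine ext_inner_right ℂ fun g => ?_
    rw [ContinuousLinearMap.adjoint_inner_left, L2.inner_def, L2.inner_def]
    have h1 : ∫ a, inner ℂ (f a) ((LpToLpRestrictCLM X ℂ ℂ ν 2 W) g a) ∂(ν.restrict W)
        = ∫ a in W, inner ℂ (f a) (g a) ∂ν := by
      refine integral_congr_ae ?_
      filter_upwards [LpToLpRestrictCLM_coeFn ℂ W g] with a ha
      rw [ha]
    rw [h1, ← integral_indicator hW]
    refine integral_congr_ae ?_
    filter_upwards [hmem.coeFn_toLp] with a ha
    rw [ha]
    by_cases h : a ∈ W <;> simp [h]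
  rw [this]
  exact hmem.coeFn_toLp

variable {X : Type*} [AddCommGroup X] [MeasurableSpace X] [MeasurableAdd₂ X] [MeasurableNeg X]
  {ν : Measure X} [SFinite ν] [ν.IsAddLeftInvariant] [ν.IsNegInvariant] {W : Set X}

/-- The representative `F` of the extension by zero is left free, so that it can later be a
character cut off to `W`, given by an everywhere-defined formula. -/
theorem inner_windowOperator {k : X → ℝ} (hk : Integrable k ν) (hW : MeasurableSet W)
    (f : Lp ℂ 2 (ν.restrict W)) {F : X → ℂ} (hF : F =ᵐ[ν] W.indicator f) :
    inner ℂ (windowOperator k hk W f) f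
      = ∫ s, F s * ∫ t, (k (s - t) : ℂ) * (starRingEnd ℂ) (F t) ∂ν ∂ν := by
  rw [windowOperator, ContinuousLinearMap.comp_apply, ContinuousLinearMap.comp_apply,
    ← ContinuousLinearMap.adjoint_inner_right, L2.inner_def]
  have hA := (adjoint_restrict_coeFn hW f).trans hF.symm
  refine integral_congr_ae ?_
  filter_upwards [convOperator_coeFn k hk
    (ContinuousLinearMap.adjoint (LpToLpRestrictCLM X ℂ ℂ ν 2 W) f), hA] with s h1 h2
  rw [h1, h2, RCLike.inner_apply, ← integral_conj]
  congr 1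
  refine integral_congr_ae ?_
  filter_upwards [hA] with t ht
  rw [ht, map_mul, Complex.conj_ofReal]

end WindowOperator

/-! ### Characters and the diagonalisation of convolution forms. -/

/-- A measurable family of characters `t ↦ e t x` of `X`, indexed by `x : Y`. -/
structure IsCharacterFamily {X Y : Type*} [AddCommGroup X] [MeasurableSpace X] [MeasurableSpace Y]
    (e : X → Y → ℂ) : Prop where
  measurable : Measurable fun p : X × Y => e p.1 p.2
  norm_eq : ∀ t x, ‖e t x‖ = 1
  map_sub : ∀ s t x, e (s - t) x = e s x * (starRingEnd ℂ) (e t x)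

namespace IsCharacterFamily

variable {X Y : Type*} [AddCommGroup X] [MeasurableSpace X] [MeasurableSpace Y] {e : X → Y → ℂ}
  {ν : Measure X} {W : Set X}

theorem mul_conj_self (he : IsCharacterFamily e) (t : X) (x : Y) :
    e t x * (starRingEnd ℂ) (e t x) = 1 := by
  rw [Complex.mul_conj, Complex.normSq_eq_norm_sq, he.norm_eq]
  simp

theorem measurable_left (he : IsCharacterFamily e) (x : Y) : Measurable fun t => e t x :=
  he.measurable.comp (measurable_id.prodMk measurable_const)

theorem measurable_right (he : IsCharacterFamily e) (t : X) : Measurable fun x => e t x :=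
  he.measurable.comp (measurable_const.prodMk measurable_id)

theorem memLp (he : IsCharacterFamily e) (hW : ν W ≠ ∞) (x : Y) :
    MemLp (fun t => e t x) 2 (ν.restrict W) := by
  have : IsFiniteMeasure (ν.restrict W) := ⟨by simpa using hW.lt_top⟩
  exact MemLp.of_bound (he.measurable_left x).aestronglyMeasurable 1
    (Eventually.of_forall fun t => (he.norm_eq t x).le)

/-- The character `t ↦ e t x` as an element of `L²(W)`. -/
noncomputable def vec (he : IsCharacterFamily e) (hW : ν W ≠ ∞) (x : Y) :
    Lp ℂ 2 (ν.restrict W) := (he.memLp hW x).toLp _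

theorem vec_coeFn (he : IsCharacterFamily e) (hW : ν W ≠ ∞) (x : Y) :
    he.vec hW x =ᵐ[ν.restrict W] fun t => e t x := (he.memLp hW x).coeFn_toLp

theorem inner_vec (he : IsCharacterFamily e) (hW : ν W ≠ ∞) (x : Y)
    (f : Lp ℂ 2 (ν.restrict W)) :
    inner ℂ (he.vec hW x) f = ∫ t in W, f t * (starRingEnd ℂ) (e t x) ∂ν := by
  rw [L2.inner_def]
  refine integral_congr_ae ?_
  filter_upwards [he.vec_coeFn hW x] with t ht
  rw [ht, RCLike.inner_apply]

theorem norm_vec_sq (he : IsCharacterFamily e) (hW : ν W ≠ ∞) (x : Y) :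
    ‖he.vec hW x‖ ^ 2 = ν.real W := by
  have h1 : inner ℂ (he.vec hW x) (he.vec hW x) = (ν.real W : ℂ) := by
    rw [he.inner_vec]
    have : ∫ t in W, he.vec hW x t * (starRingEnd ℂ) (e t x) ∂ν = ∫ t in W, (1 : ℂ) ∂ν := by
      refine integral_congr_ae ?_
      filter_upwards [he.vec_coeFn hW x] with t ht
      rw [ht, he.mul_conj_self]
    rw [this]
    simp
  rw [@norm_sq_eq_re_inner ℂ, h1]
  simp

/-- The transform of an integrable function is bounded. -/
theorem norm_transform_le (he : IsCharacterFamily e) (F : X → ℂ) (x : Y) :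
    ‖∫ t, F t * (starRingEnd ℂ) (e t x) ∂ν‖ ≤ ∫ t, ‖F t‖ ∂ν := by
  refine (norm_integral_le_integral_norm _).trans (le_of_eq ?_)
  congr 1
  ext t
  rw [norm_mul, RCLike.norm_conj, he.norm_eq, mul_one]

theorem aestronglyMeasurable_transform [SFinite ν] (he : IsCharacterFamily e) {μ : Measure Y}
    [SFinite μ] {F : X → ℂ} (hF : AEStronglyMeasurable F ν) :
    AEStronglyMeasurable (fun x => ∫ t, F t * (starRingEnd ℂ) (e t x) ∂ν) μ := by
  have h : AEStronglyMeasurable (fun p : Y × X => F p.2 * (starRingEnd ℂ) (e p.2 p.1))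
      (μ.prod ν) := by
    refine hF.comp_snd.mul ?_
    exact (Complex.continuous_conj.measurable.comp
      (he.measurable.comp measurable_swap)).aestronglyMeasurable
  exact h.integral_prod_right'

/-- Insert the inversion formula for `k` and apply Fubini. As `k` and `h` are real, the formula may
be conjugated; that it holds only almost everywhere is enough because `t ↦ s - t` preserves `ν`. -/
theorem conv_conj_eq [MeasurableAdd₂ X] [MeasurableNeg X] [SFinite ν] [ν.IsAddLeftInvariant]
    [ν.IsNegInvariant] (he : IsCharacterFamily e) {μ : Measure Y} [SFinite μ]
    {k : X → ℝ} {h : Y → ℝ} (hh : Integrable h μ)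
    (hkh : ∀ᵐ u ∂ν, (k u : ℂ) = ∫ x, (h x : ℂ) * e u x ∂μ)
    {F : X → ℂ} (hF : Integrable F ν) (s : X) :
    ∫ t, (k (s - t) : ℂ) * (starRingEnd ℂ) (F t) ∂ν
      = ∫ x, (h x : ℂ) * (starRingEnd ℂ) (∫ t, F t * (starRingEnd ℂ) (e t x) ∂ν)
        * (starRingEnd ℂ) (e s x) ∂μ := by
  have hconj : Measurable (starRingEnd ℂ) := Complex.continuous_conj.measurable
  have hhc : Integrable (fun x => (h x : ℂ)) μ := hh.ofReal
  have hae : ∀ᵐ t ∂ν, (k (s - t) : ℂ) = ∫ x, (h x : ℂ) * e (s - t) x ∂μ :=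
    (Measure.measurePreserving_sub_left ν s).quasiMeasurePreserving.ae hkh
  have hint : Integrable (fun p : X × Y => (starRingEnd ℂ) (F p.1) * (h p.2 : ℂ)
      * (e p.1 p.2 * (starRingEnd ℂ) (e s p.2))) (ν.prod μ) := by
    have hFc : Integrable (fun t => (starRingEnd ℂ) (F t)) ν :=
      Complex.conjCLE.toContinuousLinearMap.integrable_comp hF
    refine (hFc.mul_prod hhc).mul_bdd (c := 1) ?_ ?_
    · exact (he.measurable.mul (hconj.comp
        ((he.measurable_right s).comp measurable_snd))).aestronglyMeasurable
    · refine Eventually.of_forall fun p => ?_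
      rw [norm_mul, RCLike.norm_conj, he.norm_eq, he.norm_eq, mul_one]
  calc ∫ t, (k (s - t) : ℂ) * (starRingEnd ℂ) (F t) ∂ν
      = ∫ t, ∫ x, (starRingEnd ℂ) (F t) * (h x : ℂ)
          * (e t x * (starRingEnd ℂ) (e s x)) ∂μ ∂ν := by
        refine integral_congr_ae ?_
        filter_upwards [hae] with t ht
        have e1 : (k (s - t) : ℂ) = ∫ x, (h x : ℂ) * (starRingEnd ℂ) (e (s - t) x) ∂μ := by
          rw [← Complex.conj_ofReal, ht, ← integral_conj]
          simp
        rw [e1, mul_comm, ← integral_const_mul]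
        congr 1
        ext x
        rw [he.map_sub, map_mul, Complex.conj_conj]
        ring
    _ = ∫ x, ∫ t, (starRingEnd ℂ) (F t) * (h x : ℂ)
          * (e t x * (starRingEnd ℂ) (e s x)) ∂ν ∂μ := integral_integral_swap hint
    _ = _ := by
        congr 1
        ext x
        rw [← integral_conj, ← integral_const_mul, ← integral_mul_const]
        congr 1
        ext t
        rw [map_mul, Complex.conj_conj]
        ring

/-- If `k` has an integrable transform `h`, its quadratic form is diagonalised by the
characters. -/
theorem quadraticForm_eq [MeasurableAdd₂ X] [MeasurableNeg X] [SFinite ν] [ν.IsAddLeftInvariant]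
    [ν.IsNegInvariant] (he : IsCharacterFamily e) {μ : Measure Y} [SFinite μ]
    {k : X → ℝ} {h : Y → ℝ} (hh : Integrable h μ)
    (hkh : ∀ᵐ u ∂ν, (k u : ℂ) = ∫ x, (h x : ℂ) * e u x ∂μ)
    {F : X → ℂ} (hF : Integrable F ν) :
    ∫ s, F s * ∫ t, (k (s - t) : ℂ) * (starRingEnd ℂ) (F t) ∂ν ∂ν
      = ((∫ x, h x * ‖∫ t, F t * (starRingEnd ℂ) (e t x) ∂ν‖ ^ 2 ∂μ : ℝ) : ℂ) := by
  set Φ : Y → ℂ := fun x => ∫ t, F t * (starRingEnd ℂ) (e t x) ∂ν with hΦ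
  have hΦm : AEStronglyMeasurable Φ μ := he.aestronglyMeasurable_transform hF.1
  have hconj : Measurable (starRingEnd ℂ) := Complex.continuous_conj.measurable
  have hem : AEStronglyMeasurable (fun p : X × Y => (starRingEnd ℂ) (e p.1 p.2)) (ν.prod μ) :=
    (hconj.comp he.measurable).aestronglyMeasurable
  have hen : ∀ p : X × Y, ‖(starRingEnd ℂ) (e p.1 p.2)‖ ≤ 1 := fun p => by
    rw [RCLike.norm_conj, he.norm_eq]
  have hhc : Integrable (fun x => (h x : ℂ)) μ := hh.ofReal
  have hΦc : AEStronglyMeasurable (fun x => (starRingEnd ℂ) (Φ x)) μ :=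
    Complex.continuous_conj.comp_aestronglyMeasurable hΦm
  have hint2 : Integrable (fun p : X × Y => F p.1 * ((h p.2 : ℂ) * (starRingEnd ℂ) (Φ p.2))
      * (starRingEnd ℂ) (e p.1 p.2)) (ν.prod μ) := by
    have hg : Integrable (fun x => (h x : ℂ) * (starRingEnd ℂ) (Φ x)) μ := by
      refine hhc.mul_bdd (c := ∫ t, ‖F t‖ ∂ν) ?_ ?_
      · exact hΦc
      · refine Eventually.of_forall fun x => ?_
        rw [RCLike.norm_conj]
        exact he.norm_transform_le F x
    exact (hF.mul_prod hg).mul_bdd (c := 1) hem (Eventually.of_forall hen)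
  calc ∫ s, F s * ∫ t, (k (s - t) : ℂ) * (starRingEnd ℂ) (F t) ∂ν ∂ν
      = ∫ s, ∫ x, F s * ((h x : ℂ) * (starRingEnd ℂ) (Φ x)) * (starRingEnd ℂ) (e s x) ∂μ ∂ν := by
        congr 1
        ext s
        rw [he.conv_conj_eq hh hkh hF, ← integral_const_mul]
        congr 1
        ext x
        ring
    _ = ∫ x, ∫ s, F s * ((h x : ℂ) * (starRingEnd ℂ) (Φ x)) * (starRingEnd ℂ) (e s x) ∂ν ∂μ :=
        integral_integral_swap hint2
    _ = ∫ x, ((h x * ‖Φ x‖ ^ 2 : ℝ) : ℂ) ∂μ := by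
        congr 1
        ext x
        have : ∀ s, F s * ((h x : ℂ) * (starRingEnd ℂ) (Φ x)) * (starRingEnd ℂ) (e s x)
            = ((h x : ℂ) * (starRingEnd ℂ) (Φ x)) * (F s * (starRingEnd ℂ) (e s x)) := by
          intro s; ring
        simp only [this]
        rw [integral_const_mul, mul_assoc]
        change (h x : ℂ) * ((starRingEnd ℂ) (Φ x) * Φ x) = _
        rw [mul_comm ((starRingEnd ℂ) (Φ x)), Complex.mul_conj, Complex.normSq_eq_norm_sq]
        push_cast
        ring
    _ = _ := integral_ofReal

end IsCharacterFamily

/-- `k` and `h` are integrable and are Fourier transforms of each other almost everywhere, with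
respect to the characters `e`, and `h` takes values in `[0, M]`. -/
structure IsFourierPair {X Y : Type*} [MeasurableSpace X] [MeasurableSpace Y] (ν : Measure X)
    (μ : Measure Y) (e : X → Y → ℂ) (k : X → ℝ) (h : Y → ℝ) (M : ℝ) : Prop where
  integrable_kernel : Integrable k ν
  integrable : Integrable h μ
  transform_eq : ∀ᵐ x ∂μ, (h x : ℂ) = ∫ u, (k u : ℂ) * (starRingEnd ℂ) (e u x) ∂ν
  inversion : ∀ᵐ u ∂ν, (k u : ℂ) = ∫ x, (h x : ℂ) * e u x ∂μ
  nonneg : ∀ᵐ x ∂μ, 0 ≤ h x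
  le : ∀ᵐ x ∂μ, h x ≤ M

/-- Bessel's inequality for the transform associated with the characters `e`. -/
def BesselInequality {X Y : Type*} [MeasurableSpace X] [MeasurableSpace Y] (ν : Measure X)
    (μ : Measure Y) (e : X → Y → ℂ) : Prop :=
  ∀ F : X → ℂ, Integrable F ν → MemLp F 2 ν →
    Integrable (fun x => ‖∫ t, F t * (starRingEnd ℂ) (e t x) ∂ν‖ ^ 2) μ ∧
      ∫ x, ‖∫ t, F t * (starRingEnd ℂ) (e t x) ∂ν‖ ^ 2 ∂μ ≤ ∫ t, ‖F t‖ ^ 2 ∂ν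

theorem Lp_two_norm_sq {X : Type*} [MeasurableSpace X] {ν : Measure X} (f : Lp ℂ 2 ν) :
    ‖f‖ ^ 2 = ∫ t, ‖f t‖ ^ 2 ∂ν := by
  rw [@norm_sq_eq_re_inner ℂ, L2.inner_def]
  have : ∀ t, inner ℂ (f t) (f t) = ((‖f t‖ ^ 2 : ℝ) : ℂ) := by
    intro t
    rw [inner_self_eq_norm_sq_to_K]
    norm_cast
  simp only [this]
  have e : ∫ t, ((‖f t‖ ^ 2 : ℝ) : ℂ) ∂ν = ((∫ t, ‖f t‖ ^ 2 ∂ν : ℝ) : ℂ) := integral_ofReal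
  rw [e]
  simp

/-! ### Window operators as frame operators, and the uniform asymptotics. -/

section Window

variable {X Y : Type*} [AddCommGroup X] [MeasurableSpace X] [MeasurableAdd₂ X] [MeasurableNeg X]
  {ν : Measure X} [SFinite ν] [ν.IsAddLeftInvariant] [ν.IsNegInvariant]
  [MeasurableSpace Y] {μ : Measure Y} [SFinite μ] {e : X → Y → ℂ} {k : X → ℝ} {h : Y → ℝ} {M : ℝ}
  {W : Set X}

/-- Since `W` has finite measure, the extension by zero of a function in `L²(W)` lies in both `L¹`
and `L²`, so the diagonalised quadratic form and Bessel's inequality both apply to it. -/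
theorem IsFourierPair.isFrameOperator (hp : IsFourierPair ν μ e k h M)
    (he : IsCharacterFamily e) (hB : BesselInequality ν μ e) (hM0 : 0 ≤ M) (hM1 : M < 1)
    (hW : MeasurableSet W) (hWf : ν W ≠ ∞) (hk : Integrable k ν) :
    IsFrameOperator μ (he.vec hWf) h (ν.real W) M (windowOperator k hk W) := by
  have hfin : IsFiniteMeasure (ν.restrict W) := ⟨by simpa using hWf.lt_top⟩
  have hL2 : ∀ f : Lp ℂ 2 (ν.restrict W), MemLp (W.indicator f) 2 ν := fun f =>
    (memLp_indicator_iff_restrict hW).mpr (Lp.memLp f)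
  have hL1 : ∀ f : Lp ℂ 2 (ν.restrict W), Integrable (W.indicator f) ν := fun f =>
    (integrable_indicator_iff hW).mpr ((Lp.memLp f).integrable (by norm_num))
  have hinner : ∀ (f : Lp ℂ 2 (ν.restrict W)) x, inner ℂ (he.vec hWf x) f
      = ∫ t, W.indicator f t * (starRingEnd ℂ) (e t x) ∂ν := by
    intro f x
    rw [he.inner_vec, ← integral_indicator hW]
    congr 1
    ext t
    by_cases ht : t ∈ W <;> simp [ht]
  have hnorm : ∀ f : Lp ℂ 2 (ν.restrict W), ‖f‖ ^ 2 = ∫ t, ‖W.indicator f t‖ ^ 2 ∂ν := by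
    intro f
    rw [Lp_two_norm_sq, ← integral_indicator hW]
    congr 1
    ext t
    by_cases ht : t ∈ W <;> simp [ht]
  refine ⟨hM0, hM1, fun f => ?_, he.norm_vec_sq hWf, hp.integrable, hp.nonneg, hp.le, fun f => ?_,
    fun f => ?_⟩
  · simp only [hinner]
    exact he.aestronglyMeasurable_transform (hL1 f).1
  · simp only [hinner, hnorm]
    exact hB _ (hL1 f) (hL2 f)
  · rw [inner_windowOperator hk hW f (EventuallyEq.refl _ _),
      he.quadraticForm_eq hp.integrable hp.inversion (hL1 f)]
    simp only [hinner]

theorem measurable_measure_translate_diff {X : Type*} [AddCommGroup X] [MeasurableSpace X]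
    [MeasurableAdd₂ X] [MeasurableNeg X] {ν : Measure X} [SFinite ν] {W : Set X}
    (hW : MeasurableSet W) : Measurable fun u => ν {s | s ∈ W ∧ s - u ∉ W} := by
  have hS : MeasurableSet {p : X × X | p.2 ∈ W ∧ p.2 - p.1 ∉ W} := by
    refine (measurable_snd hW).inter ?_
    exact ((measurable_snd.sub measurable_fst) hW).compl
  exact measurable_measure_prodMk_left hS

/-- The diagonal of a window operator along the characters is close to the Fourier transform of its
kernel. -/
theorem IsCharacterFamily.enorm_inner_vec_sub_le (he : IsCharacterFamily e)
    (hW : MeasurableSet W) (hWf : ν W ≠ ∞) (hk : Integrable k ν) {x : Y} {c : ℝ}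
    (hc : (c : ℂ) = ∫ u, (k u : ℂ) * (starRingEnd ℂ) (e u x) ∂ν) :
    ‖inner ℂ (windowOperator k hk W (he.vec hWf x)) (he.vec hWf x) - ((ν.real W * c : ℝ) : ℂ)‖ₑ
      ≤ ∫⁻ u, ‖k u‖ₑ * ν {s | s ∈ W ∧ s - u ∉ W} ∂ν := by
  have hfin : IsFiniteMeasure (ν.restrict W) := ⟨by simpa using hWf.lt_top⟩
  set F : X → ℂ := W.indicator fun t => e t x with hF
  have hFae : F =ᵐ[ν] W.indicator (he.vec hWf x) := by
    have := (ae_restrict_iff' hW).mp (he.vec_coeFn hWf x)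
    filter_upwards [this] with t ht
    by_cases h : t ∈ W
    · simp [hF, h, ht h]
    · simp [hF, h]
  set g : X → ℂ := fun u => (k u : ℂ) * e u x with hg
  have hgint : Integrable g ν := by
    refine hk.ofReal.mul_bdd (c := 1) (he.measurable_left x).aestronglyMeasurable ?_
    exact Eventually.of_forall fun u => (he.norm_eq u x).le
  -- Both `c` and `k` are real, so the character in the transform may be replaced by its conjugate.
  have hc' : (c : ℂ) = ∫ u, g u ∂ν := by
    rw [← Complex.conj_ofReal, hc, ← integral_conj]
    simp [hg]
  set A : X → Set X := fun s => {u | s - u ∈ W} with hA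
  have hAm : ∀ s, MeasurableSet (A s) := fun s => (measurable_id.const_sub s) hW
  -- After the substitution `u = s - t`, the product of characters depends on `u` alone. Only shifts
  -- keeping `s - u` in `W` occur; integrating over all `u` would give exactly `ν.real W * c`, so
  -- the error comes from the complement of `A s`.
  have h1 : inner ℂ (windowOperator k hk W (he.vec hWf x)) (he.vec hWf x)
      = ∫ s in W, ∫ u, (A s).indicator g u ∂ν ∂ν := by
    rw [inner_windowOperator hk hW _ hFae, ← integral_indicator hW]
    congr 1
    ext s
    by_cases hs : s ∈ W
    · rw [Set.indicator_of_mem hs,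
        ← integral_sub_left_eq_self (fun u => (A s).indicator g u) ν s, hF,
        Set.indicator_of_mem hs, ← integral_const_mul]
      congr 1
      ext t
      by_cases ht : t ∈ W
      · have : s - t ∈ A s := by simpa [hA] using ht
        rw [Set.indicator_of_mem ht, Set.indicator_of_mem this, hg]
        dsimp only
        rw [he.map_sub]
        ring
      · have : s - t ∉ A s := by simpa [hA] using ht
        rw [Set.indicator_of_notMem ht, Set.indicator_of_notMem this]
        simp
    · rw [Set.indicator_of_notMem hs, hF, Set.indicator_of_notMem hs, zero_mul]
  have h2 : ((ν.real W * c : ℝ) : ℂ) = ∫ s in W, ∫ u, g u ∂ν ∂ν := by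
    rw [setIntegral_const, Complex.ofReal_mul, hc', Complex.real_smul]
  have hmeas : AEStronglyMeasurable (fun s => ∫ u, (A s).indicator g u ∂ν) (ν.restrict W) := by
    have hS : MeasurableSet {p : X × X | p.1 - p.2 ∈ W} :=
      (measurable_fst.sub measurable_snd) hW
    have : AEStronglyMeasurable ({p : X × X | p.1 - p.2 ∈ W}.indicator fun p => g p.2)
        ((ν.restrict W).prod ν) := hgint.1.comp_snd.indicator hS
    exact this.integral_prod_right'
  have hint : Integrable (fun s => ∫ u, (A s).indicator g u ∂ν) (ν.restrict W) := by
    refine Integrable.of_bound hmeas (∫ u, ‖g u‖ ∂ν) (Eventually.of_forall fun s => ?_)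
    refine (norm_integral_le_integral_norm _).trans ?_
    refine integral_mono (hgint.indicator (hAm s)).norm hgint.norm fun u => ?_
    exact norm_indicator_le_norm_self g u
  rw [h1, h2, ← integral_sub hint (integrable_const _)]
  have h3 : ∀ s, (∫ u, (A s).indicator g u ∂ν) - ∫ u, g u ∂ν
      = - ∫ u, (A s)ᶜ.indicator g u ∂ν := by
    intro s
    rw [integral_indicator (hAm s), integral_indicator (hAm s).compl,
      ← integral_add_compl (hAm s) hgint]
    ring
  simp only [h3]
  calc ‖∫ s in W, -∫ u, (A s)ᶜ.indicator g u ∂ν ∂ν‖ₑ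
      ≤ ∫⁻ s in W, ‖-∫ u, (A s)ᶜ.indicator g u ∂ν‖ₑ ∂ν := enorm_integral_le_lintegral_enorm _
    _ ≤ ∫⁻ s in W, ∫⁻ u, ‖(A s)ᶜ.indicator g u‖ₑ ∂ν ∂ν := by
        refine lintegral_mono fun s => ?_
        rw [enorm_neg]
        exact enorm_integral_le_lintegral_enorm _
    _ = ∫⁻ s in W, ∫⁻ u, ‖k u‖ₑ * (A s)ᶜ.indicator 1 u ∂ν ∂ν := by
        congr 1
        ext s
        congr 1
        ext u
        by_cases hu : u ∈ A s
        · simp [hu]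
        · rw [Set.indicator_of_mem hu, Set.indicator_of_mem hu, hg]
          dsimp only
          rw [enorm_mul, ← ofReal_norm (e u x), he.norm_eq, ← ofReal_norm (k u : ℂ),
            Complex.norm_real, ofReal_norm]
          simp
    _ = ∫⁻ u, ∫⁻ s in W, ‖k u‖ₑ * (A s)ᶜ.indicator 1 u ∂ν ∂ν := by
        refine lintegral_lintegral_swap ?_
        refine (hk.1.comp_snd.enorm).mul ?_
        have hS : MeasurableSet {p : X × X | p.1 - p.2 ∈ W}ᶜ :=
          ((measurable_fst.sub measurable_snd) hW).compl
        exact (measurable_const.indicator hS (f := fun _ => (1 : ℝ≥0∞))).aemeasurable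
    _ = _ := by
        congr 1
        ext u
        have hS : MeasurableSet {s | s - u ∉ W} := ((measurable_id.sub_const u) hW).compl
        have e1 : ∀ s, (A s)ᶜ.indicator (1 : X → ℝ≥0∞) u = {s | s - u ∉ W}.indicator 1 s := by
          intro s
          by_cases hs : s - u ∈ W <;> simp [hA, Set.indicator, hs]
        simp only [e1]
        rw [lintegral_const_mul _ (measurable_one.indicator hS), lintegral_indicator_one hS,
          Measure.restrict_apply hS]
        congr 2
        ext s
        simp [and_comm]

/-- Dominated convergence: the ratio of measures is at most 1, so `G` itself dominates. -/
theorem tendsto_lintegral_translate_diff {X : Type*} [AddCommGroup X] [MeasurableSpace X]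
    [MeasurableAdd₂ X] [MeasurableNeg X] {ν : Measure X} [SFinite ν] {G : X → ℝ≥0∞} (hG : AEMeasurable G ν)
    (hGf : ∫⁻ u, G u ∂ν ≠ ∞) {W : ℕ → Set X} (hW : ∀ n, MeasurableSet (W n))
    (hlim : ∀ u, Tendsto (fun n => ν {s | s ∈ W n ∧ s - u ∉ W n} / ν (W n)) atTop (𝓝 0)) :
    Tendsto (fun n => ∫⁻ u, G u * (ν {s | s ∈ W n ∧ s - u ∉ W n} / ν (W n)) ∂ν) atTop (𝓝 0) := by
  rw [show (0 : ℝ≥0∞) = ∫⁻ _, 0 ∂ν by simp]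
  refine tendsto_lintegral_of_dominated_convergence' G (fun n => ?_) (fun n => ?_) hGf ?_
  · exact hG.mul ((measurable_measure_translate_diff (hW n)).div_const _).aemeasurable
  · refine Eventually.of_forall fun u => ?_
    refine mul_le_of_le_one_right zero_le ?_
    refine (ENNReal.div_le_div_right (measure_mono fun s hs => hs.1) _).trans ENNReal.div_self_le_one
  · filter_upwards [ae_lt_top' hG hGf] with u hu
    have := ENNReal.Tendsto.const_mul (hlim u) (Or.inr hu.ne)
    simpa using this

/-- Uniform Szegő asymptotics for window operators, for a family of Fourier pairs. -/
theorem uniform_szego [MeasurableSpace.CountablyGenerated X] {Θ : Type*}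
    {K : Θ → X → ℝ} {h : Θ → Y → ℝ} {C : ℝ}
    (hK : ∀ θ, Integrable (K θ) ν) (he : IsCharacterFamily e) (hB : BesselInequality ν μ e)
    (hM0 : 0 ≤ M) (hM1 : M < 1) (hp : ∀ θ, IsFourierPair ν μ e (K θ) (h θ) M)
    (hC : ∀ θ, ∫ x, h θ x ∂μ ≤ C) (hS : SupIntegrable ν K)
    {W : ℕ → Set X} (hW : ∀ n, MeasurableSet (W n)) (hWf : ∀ n, ν (W n) ≠ ∞)
    (hWpos : ∀ᶠ n in atTop, 0 < ν.real (W n))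
    (hlim : ∀ u, Tendsto (fun n => ν {s | s ∈ W n ∧ s - u ∉ W n} / ν (W n)) atTop (𝓝 0)) :
    (∀ θ n, IsSelfAdjointTraceClass (windowOperator (K θ) (hK θ) (W n)) ∧
      0 < fredholmDet (windowOperator (K θ) (hK θ) (W n))) ∧
    (∀ θ, Integrable (fun x => Real.log (1 - h θ x)) μ) ∧
    Tendsto (fun n => ⨆ θ, ENNReal.ofReal
      |1 / ν.real (W n) * Real.log (fredholmDet (windowOperator (K θ) (hK θ) (W n)))
        - ∫ x, Real.log (1 - h θ x) ∂μ|) atTop (𝓝 0) := by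
  -- Lets instance search find that `L²(W)` is separable, as `traceClass_and_det` requires.
  have : Fact ((2 : ℝ≥0∞) ≠ ∞) := ⟨by norm_num⟩
  have hF : ∀ θ n, IsFrameOperator μ (he.vec (hWf n)) (h θ) (ν.real (W n)) M
      (windowOperator (K θ) (hK θ) (W n)) := fun θ n =>
    (hp θ).isFrameOperator he hB hM0 hM1 (hW n) (hWf n) (hK θ)
  refine ⟨fun θ n => ⟨(hF θ n).traceClass_and_det.1, (hF θ n).traceClass_and_det.2.1⟩,
    fun θ => (hF θ 0).integrable_log, ?_⟩
  set G : X → ℝ≥0∞ := fun u => ⨆ θ, ENNReal.ofReal |K θ u| with hG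
  set D : ℕ → X → ℝ≥0∞ := fun n u => ν {s | s ∈ W n ∧ s - u ∉ W n} with hD
  -- Built from the supremum of the kernels, `δ n` bounds the relative deviation of the diagonal for
  -- all `θ` at once.
  set δ : ℕ → ℝ≥0∞ := fun n => ∫⁻ u, G u * (D n u / ν (W n)) ∂ν with hδ
  have hδlim : Tendsto δ atTop (𝓝 0) := tendsto_lintegral_translate_diff hS.1 hS.2 hW hlim
  have hδfin : ∀ n, δ n ≠ ∞ := by
    intro n
    refine ne_top_of_le_ne_top hS.2 (lintegral_mono fun u => ?_)
    refine mul_le_of_le_one_right zero_le ?_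
    exact (ENNReal.div_le_div_right (measure_mono fun s hs => hs.1) _).trans
      ENNReal.div_self_le_one
  have hbound : Tendsto (fun n => ENNReal.ofReal ((δ n).toReal * (C / (1 - M)))) atTop (𝓝 0) := by
    have h1 := (ENNReal.tendsto_toReal ENNReal.zero_ne_top).comp hδlim
    have h2 := ENNReal.tendsto_ofReal (h1.mul_const (C / (1 - M)))
    simpa using h2
  refine tendsto_of_tendsto_of_tendsto_of_le_of_le' tendsto_const_nhds hbound
    (Eventually.of_forall fun n => zero_le) ?_
  filter_upwards [hWpos] with n hn
  refine iSup_le fun θ => ENNReal.ofReal_le_ofReal ?_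
  have hνpos : ν (W n) ≠ 0 := fun h0 => by simp [Measure.real, h0] at hn
  have hdev : ∀ᵐ x ∂μ, |(inner ℂ (windowOperator (K θ) (hK θ) (W n) (he.vec (hWf n) x))
      (he.vec (hWf n) x)).re - ν.real (W n) * h θ x| ≤ ν.real (W n) * (δ n).toReal := by
    filter_upwards [(hp θ).transform_eq] with x hx
    have h1 := he.enorm_inner_vec_sub_le (hW n) (hWf n) (hK θ) hx
    have h2 : ∫⁻ u, ‖K θ u‖ₑ * D n u ∂ν ≤ ν (W n) * δ n := by
      have hm : AEMeasurable (fun u => G u * (D n u / ν (W n))) ν := hS.1.mul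
        ((measurable_measure_translate_diff (hW n)).div_const _).aemeasurable
      rw [hδ]
      dsimp only
      rw [← lintegral_const_mul'' _ hm]
      refine lintegral_mono fun u => ?_
      rw [mul_left_comm, ENNReal.mul_div_cancel hνpos (hWf n)]
      gcongr
      rw [← ofReal_norm, Real.norm_eq_abs]
      exact le_iSup (fun θ => ENNReal.ofReal |K θ u|) θ
    have h3 := ENNReal.toReal_mono (ENNReal.mul_ne_top (hWf n) (hδfin n)) (h1.trans h2)
    rw [ENNReal.toReal_mul, toReal_enorm] at h3
    refine le_trans ?_ h3
    refine le_trans (le_of_eq ?_) (Complex.abs_re_le_norm _)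
    rw [Complex.sub_re, Complex.ofReal_re]
  have hmain := (hF θ n).traceClass_and_det.2.2 _ hdev
  -- The other factor of the error is also bounded independently of `θ`, because `M < 1` and `∫ h θ
  -- ≤ C`.
  have hq : ∫ x, h θ x / (1 - h θ x) ∂μ ≤ C / (1 - M) := by
    have : ∫ x, h θ x / (1 - h θ x) ∂μ ≤ ∫ x, h θ x / (1 - M) ∂μ := by
      refine integral_mono_ae (hF θ n).integrable_div_one_sub ((hp θ).integrable.div_const _) ?_
      filter_upwards [(hp θ).nonneg, (hp θ).le] with x h0 h1
      have : 0 < 1 - M := by linarith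
      gcongr
    refine this.trans ?_
    rw [integral_div]
    have : 0 < 1 - M := by linarith
    gcongr
    exact hC θ
  have e1 : 1 / ν.real (W n) * Real.log (fredholmDet (windowOperator (K θ) (hK θ) (W n)))
        - ∫ x, Real.log (1 - h θ x) ∂μ = (ν.real (W n))⁻¹ *
      (Real.log (fredholmDet (windowOperator (K θ) (hK θ) (W n)))
        - ν.real (W n) * ∫ x, Real.log (1 - h θ x) ∂μ) := by
    field_simp
  rw [e1, abs_mul, abs_of_pos (inv_pos.mpr hn)]
  calc _ ≤ (ν.real (W n))⁻¹ *
        (ν.real (W n) * (δ n).toReal * ∫ x, h θ x / (1 - h θ x) ∂μ) := by gcongr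
    _ = (δ n).toReal * ∫ x, h θ x / (1 - h θ x) ∂μ := by field_simp
    _ ≤ _ := by gcongr

end Window

/-! ### Growing windows and translation across their boundary. -/

section Windows

variable {X : Type*} [TopologicalSpace X] [MeasurableSpace X] {ν : Measure X} {δ : X → X → ℝ}
  {bdry : Set X → Set X} {W : ℕ → Set X}

/-- Terms of a convergent series tend to 0, so `exp (-|W n|)` is eventually below 1. -/
theorem WindowCondition.eventually_pos (hW : WindowCondition ν δ bdry W) :
    ∀ᶠ n in atTop, 0 < ν.real (W n) := by
  have h := (hW.summable 1 one_pos).tendsto_atTop_zero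
  filter_upwards [h.eventually_lt_const one_pos] with n hn
  have := Real.exp_lt_one_iff.mp hn
  linarith

/-- Points pushed out of `W n` by the fixed shift `u` are within `R` of the boundary. Once `r n ≥
R`, they belong to the boundary layer, of measure `o(|W n|)`. -/
theorem WindowCondition.tendsto_translate_diff [AddCommGroup X] (hW : WindowCondition ν δ bdry W)
    (hWf : ∀ n, ν (W n) ≠ ∞) {u : X} {R : ℝ}
    (hR : ∀ n, ∀ s ∈ W n, s - u ∉ W n → ∃ y ∈ bdry (W n), δ s y ≤ R) :
    Tendsto (fun n => ν {s | s ∈ W n ∧ s - u ∉ W n} / ν (W n)) atTop (𝓝 0) := by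
  obtain ⟨r, -, -, hr, hlit⟩ := hW.boundary
  have h1 := hlit.tendsto_div_nhds_zero
  have h2 := ENNReal.tendsto_ofReal h1
  rw [ENNReal.ofReal_zero] at h2
  refine tendsto_of_tendsto_of_tendsto_of_le_of_le' tendsto_const_nhds h2
    (Eventually.of_forall fun n => zero_le) ?_
  filter_upwards [hr.eventually_ge_atTop R, hW.eventually_pos] with n hn hpos
  rw [ENNReal.ofReal_div_of_pos hpos, ofReal_measureReal (hWf n), ofReal_measureReal
    (ne_top_of_le_ne_top (hWf n) (measure_mono Set.inter_subset_right))]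
  refine ENNReal.div_le_div_right (measure_mono ?_) _
  rintro s ⟨hs, hsu⟩
  obtain ⟨y, hy, hd⟩ := hR n s hs hsu
  exact ⟨⟨y, hy, hd.trans hn⟩, hs⟩

end Windows

theorem IsPreconnected.inter_frontier_nonempty {X : Type*} [TopologicalSpace X] {S A : Set X}
    (hS : IsPreconnected S) (h1 : (S ∩ A).Nonempty) (h2 : (S ∩ Aᶜ).Nonempty) :
    (S ∩ frontier A).Nonempty := by
  by_contra h
  have hsub : S ⊆ interior A ∪ interior Aᶜ := by
    rw [← compl_frontier_eq_union_interior]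
    exact fun x hx hxf => h ⟨x, hx, hxf⟩
  obtain ⟨a, haS, haA⟩ := h1
  obtain ⟨b, hbS, hbA⟩ := h2
  have ha : a ∈ interior A := (hsub haS).resolve_right fun h => interior_subset h haA
  have hb : b ∈ interior Aᶜ := (hsub hbS).resolve_left fun h => hbA (interior_subset h)
  obtain ⟨c, -, hc1, hc2⟩ := hS _ _ isOpen_interior isOpen_interior hsub ⟨a, haS, ha⟩ ⟨b, hbS, hb⟩
  exact interior_subset hc2 (interior_subset hc1)

/-- The segment from `s` to `s - u` is connected, hence meets the frontier, and has length `‖u‖`. -/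
theorem exists_mem_frontier_dist_le {V : Type*} [NormedAddCommGroup V] [NormedSpace ℝ V]
    {A : Set V} {s u : V} (hs : s ∈ A) (hsu : s - u ∉ A) :
    ∃ y ∈ frontier A, dist s y ≤ ‖u‖ := by
  obtain ⟨y, hy, hyf⟩ := (convex_segment s (s - u)).isPreconnected.inter_frontier_nonempty
    ⟨s, left_mem_segment ℝ _ _, hs⟩ ⟨s - u, right_mem_segment ℝ _ _, hsu⟩
  refine ⟨y, hyf, ?_⟩
  obtain ⟨t, ht, rfl⟩ := segment_eq_image' ℝ s (s - u) ▸ hy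
  rw [dist_eq_norm]
  have : s - (s + t • (s - u - s)) = t • u := by
    rw [sub_sub_cancel_left, smul_neg]; abel
  rw [this, norm_smul, Real.norm_of_nonneg ht.1]
  exact mul_le_of_le_one_left (norm_nonneg _) ht.2

/-! ### Fourier analysis on a Euclidean space. -/

section FourierInnerProductSpace

variable {V : Type*} [NormedAddCommGroup V] [InnerProductSpace ℝ V] [FiniteDimensional ℝ V]
  [MeasurableSpace V] [BorelSpace V]

theorem integral_fourier_smul_eq_integral_smul_fourier {f g : V → ℂ} (hf : Integrable f)
    (hg : Integrable g) : ∫ x, 𝓕 f x • g x = ∫ x, f x • 𝓕 g x := by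
  have := VectorFourier.integral_fourierIntegral_smul_eq_flip (L := innerₗ V)
    (μ := volume) (ν := volume) Real.continuous_fourierChar continuous_inner hf hg
  simpa using! this

/-- Fourier inversion almost everywhere. -/
theorem ae_fourierInv_fourier_eq {f : V → ℂ} (hf : Integrable f) (hf' : Integrable (𝓕 f)) :
    ∀ᵐ x, f x = 𝓕⁻ (𝓕 f) x := by
  have hcont : Continuous (𝓕⁻ (𝓕 f)) := by
    rw [Real.fourierInv_eq_fourier_comp_neg]
    exact VectorFourier.fourierIntegral_continuous Real.continuous_fourierChar continuous_inner
      hf'.comp_neg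
  -- Both sides are tested against smooth compactly supported functions. These are Schwartz
  -- functions, for which inversion is known, and the transform moves across the pairing.
  refine ae_eq_of_integral_contDiff_smul_eq hf.locallyIntegrable
    hcont.locallyIntegrable fun g hg1 hg2 => ?_
  have hc1 : ContDiff ℝ (⊤ : ℕ∞) fun x => (g x : ℂ) := Complex.ofRealCLM.contDiff.comp hg1
  have hc2 : HasCompactSupport fun x => (g x : ℂ) := hg2.comp_left Complex.ofReal_zero
  let G : SchwartzMap V ℂ := hc2.toSchwartzMap hc1
  have hG : ∀ x, G x = g x := fun x => rfl
  have hGi : Integrable G := G.integrable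
  have e1 : ∫ x, g x • f x = ∫ x, 𝓕⁻ (G : V → ℂ) x • 𝓕 f x := by
    have h1 : Integrable (𝓕⁻ (G : V → ℂ)) := by
      rw [← SchwartzMap.fourierInv_coe]
      exact (𝓕⁻ G).integrable
    rw [← integral_fourier_smul_eq_integral_smul_fourier h1 hf]
    have h2 : 𝓕 (𝓕⁻ (G : V → ℂ)) = G := by
      rw [← SchwartzMap.fourierInv_coe, ← SchwartzMap.fourier_coe]
      simp
    rw [h2]
    congr 1
  have e2 : ∫ x, g x • 𝓕⁻ (𝓕 f) x = ∫ x, 𝓕⁻ (G : V → ℂ) x • 𝓕 f x := by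
    calc ∫ x, g x • 𝓕⁻ (𝓕 f) x = ∫ x, G (-x) • 𝓕 (𝓕 f) x := by
          rw [← integral_neg_eq_self]
          congr 1
          ext x
          rw [Real.fourierInv_eq_fourier_neg, neg_neg, hG]
          rfl
      _ = ∫ x, 𝓕 (fun x => G (-x)) x • 𝓕 f x :=
          (integral_fourier_smul_eq_integral_smul_fourier hGi.comp_neg hf').symm
      _ = _ := by
          rw [Real.fourierInv_eq_fourier_comp_neg]
  rw [e1, e2]

/-- The integral transform and the `L²` transform define the same tempered distribution; this
carries the `L²` isometry over to the integral formula. -/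
theorem ae_fourier_eq_fourier_toLp {f : V → ℂ} (hf : Integrable f) (hf2 : MemLp f 2) :
    ∀ᵐ x, 𝓕 f x = (𝓕 (hf2.toLp f) : Lp ℂ 2 (volume : Measure V)) x := by
  have hcont : Continuous (𝓕 f) :=
    VectorFourier.fourierIntegral_continuous Real.continuous_fourierChar continuous_inner hf
  refine ae_eq_of_integral_contDiff_smul_eq hcont.locallyIntegrable
    ((Lp.memLp _).locallyIntegrable (by norm_num)) fun g hg1 hg2 => ?_
  have hc1 : ContDiff ℝ (⊤ : ℕ∞) fun x => (g x : ℂ) := Complex.ofRealCLM.contDiff.comp hg1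
  have hc2 : HasCompactSupport fun x => (g x : ℂ) := hg2.comp_left Complex.ofReal_zero
  let G : SchwartzMap V ℂ := hc2.toSchwartzMap hc1
  have hG : ∀ x (z : ℂ), g x • z = G x • z := fun x z => rfl
  simp only [hG]
  rw [← integral_fourier_smul_eq_integral_smul_fourier G.integrable hf,
    ← Lp.toTemperedDistribution_apply, ← Lp.fourier_toTemperedDistribution_eq,
    TemperedDistribution.fourier_apply, Lp.toTemperedDistribution_apply]
  refine integral_congr_ae ?_
  filter_upwards [hf2.coeFn_toLp] with x hx
  rw [hx, SchwartzMap.fourier_coe]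

/-- Plancherel's theorem for functions in `L¹ ∩ L²`. -/
theorem integrable_and_integral_norm_fourier_sq {f : V → ℂ} (hf : Integrable f)
    (hf2 : MemLp f 2) :
    Integrable (fun x => ‖𝓕 f x‖ ^ 2) ∧ ∫ x, ‖𝓕 f x‖ ^ 2 = ∫ x, ‖f x‖ ^ 2 := by
  have hae := ae_fourier_eq_fourier_toLp hf hf2
  have hmem : MemLp (𝓕 f) 2 := (memLp_congr_ae hae).mpr (Lp.memLp _)
  refine ⟨hmem.integrable_norm_pow (by norm_num), ?_⟩
  have h1 := Lp_two_norm_sq (𝓕 (hf2.toLp f) : Lp ℂ 2 (volume : Measure V))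
  rw [Lp.norm_fourier_eq, Lp_two_norm_sq] at h1
  calc ∫ x, ‖𝓕 f x‖ ^ 2 = _ := integral_congr_ae (by
        filter_upwards [hae] with x hx
        rw [hx])
    _ = _ := h1.symm
    _ = _ := integral_congr_ae (by
        filter_upwards [hf2.coeFn_toLp] with x hx
        rw [hx])

theorem isCharacterFamily_inner :
    IsCharacterFamily fun t x : V => (Real.fourierChar (inner ℝ t x) : ℂ) where
  measurable := by
    refine Continuous.measurable ?_
    exact continuous_subtype_val.comp (Real.continuous_fourierChar.comp continuous_inner)
  norm_eq t x := Circle.norm_coe _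
  map_sub s t x := by
    rw [inner_sub_left, sub_eq_add_neg, AddChar.map_add_eq_mul, Circle.coe_mul,
      AddChar.map_neg_eq_inv, Circle.coe_inv_eq_conj]

theorem integral_mul_conj_fourierChar (f : V → ℂ) (x : V) :
    ∫ t, f t * (starRingEnd ℂ) (Real.fourierChar (inner ℝ t x) : ℂ) = 𝓕 f x := by
  rw [Real.fourier_eq]
  congr 1
  ext t
  rw [Circle.smul_def, AddChar.map_neg_eq_inv, Circle.coe_inv_eq_conj, smul_eq_mul, mul_comm]

theorem besselInequality_inner : BesselInequality volume volume
    fun t x : V => (Real.fourierChar (inner ℝ t x) : ℂ) := by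
  intro F hF1 hF2
  simp only [integral_mul_conj_fourierChar]
  have := integrable_and_integral_norm_fourier_sq hF1 hF2
  exact ⟨this.1, this.2.le⟩

theorem isFourierPair_fourier {k : V → ℝ} {M : ℝ} (hk : Integrable k)
    (hk' : Integrable (𝓕 (fun t => (k t : ℂ))))
    (hM : ∀ x, 𝓕 (fun t => (k t : ℂ)) x ∈ Complex.ofReal '' Set.Icc 0 M) :
    IsFourierPair volume volume (fun t x : V => (Real.fourierChar (inner ℝ t x) : ℂ)) k
      (fun x => (𝓕 (fun t => (k t : ℂ)) x).re) M := by
  have hre : ∀ x, ((𝓕 (fun t => (k t : ℂ)) x).re : ℂ) = 𝓕 (fun t => (k t : ℂ)) x := by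
    intro x
    obtain ⟨r, -, hr⟩ := hM x
    rw [← hr, Complex.ofReal_re]
  refine ⟨hk, hk'.re, Eventually.of_forall fun x => ?_, ?_, Eventually.of_forall fun x => ?_,
    Eventually.of_forall fun x => ?_⟩
  · rw [hre, integral_mul_conj_fourierChar]
  · filter_upwards [ae_fourierInv_fourier_eq hk.ofReal hk'] with u hu
    refine hu.trans ?_
    rw [Real.fourierInv_eq]
    congr 1
    ext x
    rw [hre, Circle.smul_def, smul_eq_mul, mul_comm, real_inner_comm]
    rfl
  · obtain ⟨r, hr, hr'⟩ := hM x
    rw [← hr', Complex.ofReal_re]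
    exact hr.1
  · obtain ⟨r, hr, hr'⟩ := hM x
    rw [← hr', Complex.ofReal_re]
    exact hr.2

/-- Inversion at the origin, valid pointwise thanks to continuity there. It turns the bound on `k 0`
into a bound on the integral of the transform. -/
theorem integral_fourier_re_eq {k : V → ℝ} (hk : Integrable k) (hk0 : ContinuousAt k 0)
    (hk' : Integrable (𝓕 (fun t => (k t : ℂ)))) :
    ∫ x, (𝓕 (fun t => (k t : ℂ)) x).re = k 0 := by
  have h1 : ContinuousAt (fun t => (k t : ℂ)) 0 :=
    Complex.continuous_ofReal.continuousAt.comp hk0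
  have h2 := hk.ofReal.fourierInv_fourier_eq hk' h1
  rw [Real.fourierInv_eq] at h2
  simp only [inner_zero_right, AddChar.map_zero_eq_one, one_smul] at h2
  have h3 := integral_re hk'
  simp only [RCLike.re_to_complex] at h3
  rw [h3, h2, Complex.ofReal_re]

end FourierInnerProductSpace

/-- The continuous case: uniform Szegő asymptotics in a Euclidean space. -/
theorem uniform_szego_fourier {V : Type*} [NormedAddCommGroup V] [InnerProductSpace ℝ V]
    [FiniteDimensional ℝ V] [MeasurableSpace V] [BorelSpace V] {Θ : Type*} {M : ℝ} (hM : M < 1)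
    (K : Θ → V → ℝ) (W : ℕ → Set V) (hK : ∀ θ, Integrable (K θ) volume)
    (hK0 : ∀ θ, ContinuousAt (K θ) 0)
    (hKf : ∀ θ, Integrable (𝓕 (fun t => (K θ t : ℂ))) volume)
    (hKM : ∀ θ x, 𝓕 (fun t => (K θ t : ℂ)) x ∈ Complex.ofReal '' Set.Icc 0 M)
    (hbdd : BddAbove (Set.range fun θ => K θ 0)) (hS : SupIntegrable volume K)
    (hW : WindowCondition volume dist frontier W) :
    (∀ θ n, IsSelfAdjointTraceClass (windowOperator (K θ) (hK θ) (W n)) ∧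
      0 < fredholmDet (windowOperator (K θ) (hK θ) (W n))) ∧
    (∀ θ, Integrable (fun x => Real.log (1 - (𝓕 (fun t => (K θ t : ℂ)) x).re)) volume) ∧
    Tendsto (fun n => ⨆ θ, ENNReal.ofReal
        |1 / volume.real (W n) *
            Real.log (fredholmDet (windowOperator (K θ) (hK θ) (W n)))
          - ∫ x, Real.log (1 - (𝓕 (fun t => (K θ t : ℂ)) x).re)|) atTop (𝓝 0) := by
  obtain ⟨C, hC⟩ := hbdd
  have hWf : ∀ n, volume (W n) ≠ ∞ := fun n => (hW.isCompact n).measure_lt_top.ne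
  -- `M` could be negative when `Θ` is empty; `max M 0` is nonnegative and still below 1.
  refine uniform_szego (M := max M 0) (C := C) hK isCharacterFamily_inner besselInequality_inner
    (le_max_right _ _) (max_lt hM one_pos) (fun θ => isFourierPair_fourier (hK θ) (hKf θ)
      fun x => ?_) (fun θ => ?_) hS (fun n => (hW.isCompact n).measurableSet) hWf
    hW.eventually_pos fun u => hW.tendsto_translate_diff hWf (R := ‖u‖)
      fun n s hs hsu => exists_mem_frontier_dist_le hs hsu
  · exact Set.image_mono (Set.Icc_subset_Icc_right (le_max_left _ _)) (hKM θ x)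
  · rw [integral_fourier_re_eq (hK θ) (hK0 θ) (hKf θ)]
    exact hC ⟨θ, rfl⟩

/-! ### Fourier series and boundaries on the lattice. -/

section Lattice

variable {d : ℕ}

theorem integral_count_eq_of_forall_ne {X : Type*} [MeasurableSpace X]
    [MeasurableSingletonClass X] {f : X → ℂ} (s : X) (hf : ∀ t, t ≠ s → f t = 0) :
    ∫ t, f t ∂Measure.count = f s := by
  have : f = ({s} : Set X).indicator f := by
    ext t
    by_cases ht : t = s
    · simp [ht]
    · simp [ht, hf t ht]
  rw [this, integral_indicator (measurableSet_singleton s), integral_singleton]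
  simp [Measure.real]

/-- The character `exp (2πi⟨t, x⟩)` of the lattice. -/
noncomputable def latticeChar (t : Fin d → ℤ) (x : Fin d → ℝ) : ℂ :=
  (Real.fourierChar (∑ i, (t i : ℝ) * x i) : ℂ)

theorem isCharacterFamily_latticeChar : IsCharacterFamily (latticeChar (d := d)) where
  measurable := by
    refine (continuous_subtype_val.comp Real.continuous_fourierChar).measurable.comp ?_
    refine Finset.measurable_sum _ fun i _ => ?_
    refine Measurable.mul ?_ ((measurable_pi_apply i).comp measurable_snd)
    exact (measurable_of_countable fun n : ℤ => (n : ℝ)).comp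
      ((measurable_pi_apply i).comp measurable_fst)
  norm_eq t x := Circle.norm_coe _
  map_sub s t x := by
    have : ∑ i, (((s - t) i : ℤ) : ℝ) * x i
        = (∑ i, (s i : ℝ) * x i) + -(∑ i, (t i : ℝ) * x i) := by
      rw [← sub_eq_add_neg, ← Finset.sum_sub_distrib]
      refine Finset.sum_congr rfl fun i _ => ?_
      rw [Pi.sub_apply]
      push_cast
      ring
    unfold latticeChar
    rw [this, AddChar.map_add_eq_mul, Circle.coe_mul, AddChar.map_neg_eq_inv,
      Circle.coe_inv_eq_conj]

theorem conj_latticeChar (t : Fin d → ℤ) (x : Fin d → ℝ) :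
    (starRingEnd ℂ) (latticeChar t x) = Complex.exp (-2 * Complex.I * (Real.pi : ℂ) *
      ((∑ i, (t i : ℝ) * x i : ℝ) : ℂ)) := by
  unfold latticeChar
  rw [← Circle.coe_inv_eq_conj, ← AddChar.map_neg_eq_inv, Real.fourierChar_apply]
  congr 1
  push_cast
  ring

theorem latticeFourier_eq_integral {f : (Fin d → ℤ) → ℝ} (hf : Integrable f Measure.count)
    (x : Fin d → ℝ) :
    latticeFourier f x = ∫ t, (f t : ℂ) * (starRingEnd ℂ) (latticeChar t x) ∂Measure.count := by
  have hint : Integrable (fun t => (f t : ℂ) * (starRingEnd ℂ) (latticeChar t x))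
      Measure.count := by
    refine hf.ofReal.mul_bdd (c := 1)
      (measurable_of_countable _).aestronglyMeasurable (Eventually.of_forall fun t => ?_)
    rw [RCLike.norm_conj, isCharacterFamily_latticeChar.norm_eq]
  rw [integral_countable hint]
  simp only [conj_latticeChar, latticeFourier]
  congr 1
  ext t
  simp [Measure.real]

theorem integral_fourierChar_int_mul (n : ℤ) :
    ∫ x in Set.Icc (0 : ℝ) 1, (Real.fourierChar ((n : ℝ) * x) : ℂ) = if n = 0 then 1 else 0 := by
  rw [integral_Icc_eq_integral_Ioc, ← intervalIntegral.integral_of_le zero_le_one]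
  split_ifs with hn
  · simp [hn]
  · have hc : (2 * Real.pi * Complex.I * n : ℂ) ≠ 0 := by
      simp [hn, Real.pi_ne_zero]
    have : ∀ x : ℝ, (Real.fourierChar ((n : ℝ) * x) : ℂ)
        = Complex.exp ((2 * Real.pi * Complex.I * n : ℂ) * x) := by
      intro x
      rw [Real.fourierChar_apply]
      congr 1
      push_cast
      ring
    simp only [this]
    rw [integral_exp_mul_complex hc]
    have h1 : Complex.exp ((2 * Real.pi * Complex.I * n : ℂ) * ((1 : ℝ) : ℂ)) = 1 := by
      rw [Complex.exp_eq_one_iff]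
      exact ⟨n, by push_cast; ring⟩
    rw [h1]
    simp

theorem integral_latticeChar (t : Fin d → ℤ) :
    ∫ x in Set.Icc (0 : Fin d → ℝ) 1, latticeChar t x = if t = 0 then 1 else 0 := by
  have hprod : ∀ x : Fin d → ℝ, latticeChar t x
      = ∏ i, (Real.fourierChar ((t i : ℝ) * x i) : ℂ) := by
    intro x
    unfold latticeChar
    simp only [Real.fourierChar_apply]
    rw [← Complex.exp_sum]
    congr 1
    push_cast
    rw [Finset.mul_sum, Finset.sum_mul]
  simp only [hprod]
  rw [← Set.pi_univ_Icc, volume_pi, Measure.restrict_pi_pi,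
    integral_fintype_prod_eq_prod (fun i (y : ℝ) => (Real.fourierChar ((t i : ℝ) * y) : ℂ))]
  simp only [Pi.zero_apply, Pi.one_apply, integral_fourierChar_int_mul]
  split_ifs with ht
  · simp [ht]
  · obtain ⟨i, hi⟩ := Function.ne_iff.mp ht
    refine Finset.prod_eq_zero (Finset.mem_univ i) ?_
    simpa using hi

instance : IsFiniteMeasure ((volume : Measure (Fin d → ℝ)).restrict (Set.Icc 0 1)) :=
  ⟨by simpa using isCompact_Icc.measure_lt_top⟩

/-- The unit mass at the origin has transform 1, by orthogonality of the characters. Diagonalising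
its quadratic form, which is `∑ ‖F s‖²`, gives Parseval's identity. -/
theorem besselInequality_latticeChar : BesselInequality (Measure.count : Measure (Fin d → ℤ))
    (volume.restrict (Set.Icc 0 1)) latticeChar := by
  intro F hF hF2
  have he := isCharacterFamily_latticeChar (d := d)
  refine ⟨?_, ?_⟩
  · refine Integrable.of_bound ((he.aestronglyMeasurable_transform hF.1).norm.pow 2)
      ((∫ t, ‖F t‖ ∂Measure.count) ^ 2) (Eventually.of_forall fun x => ?_)
    rw [Real.norm_of_nonneg (by positivity)]
    have := he.norm_transform_le (ν := Measure.count) F x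
    gcongr
  · have h1 := he.quadraticForm_eq (μ := volume.restrict (Set.Icc 0 1)) (ν := Measure.count)
      (k := Pi.single 0 1) (h := fun _ => 1) (integrable_const 1)
      (Eventually.of_forall fun u => by
        simp only [Complex.ofReal_one, one_mul]
        rw [integral_latticeChar]
        by_cases hu : u = 0 <;> simp [hu]) hF
    simp only [one_mul] at h1
    have h2 : ∀ s, ∫ t, ((Pi.single (0 : Fin d → ℤ) (1 : ℝ) : (Fin d → ℤ) → ℝ) (s - t) : ℂ)
        * (starRingEnd ℂ) (F t) ∂Measure.count = (starRingEnd ℂ) (F s) := by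
      intro s
      rw [integral_count_eq_of_forall_ne s]
      · simp
      · intro t ht
        rw [Pi.single_eq_of_ne (sub_ne_zero.mpr ht.symm)]
        simp
    simp only [h2] at h1
    have h3 : ∫ s, F s * (starRingEnd ℂ) (F s) ∂Measure.count
        = ((∫ s, ‖F s‖ ^ 2 ∂Measure.count : ℝ) : ℂ) := by
      rw [← integral_complex_ofReal]
      congr 1
      ext s
      rw [Complex.mul_conj, Complex.normSq_eq_norm_sq]
    rw [h3] at h1
    exact (Complex.ofReal_injective h1).ge

/-- Inversion holds at every lattice point: integrate the absolutely convergent series against a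
character and use orthogonality. At the origin it gives the integral of the transform. -/
theorem isFourierPair_latticeFourier {k : (Fin d → ℤ) → ℝ} {M : ℝ}
    (hk : Integrable k Measure.count)
    (hM : ∀ x ∈ Set.Icc (0 : Fin d → ℝ) 1, latticeFourier k x ∈ Complex.ofReal '' Set.Icc 0 M) :
    IsFourierPair Measure.count (volume.restrict (Set.Icc 0 1)) latticeChar k
      (fun x => (latticeFourier k x).re) M ∧
    ∫ x in Set.Icc (0 : Fin d → ℝ) 1, (latticeFourier k x).re = k 0 := by
  have he := isCharacterFamily_latticeChar (d := d)
  have hre : ∀ x ∈ Set.Icc (0 : Fin d → ℝ) 1,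
      ((latticeFourier k x).re : ℂ) = latticeFourier k x ∧ 0 ≤ (latticeFourier k x).re ∧
        (latticeFourier k x).re ≤ M := by
    intro x hx
    obtain ⟨r, hr, hr'⟩ := hM x hx
    rw [← hr', Complex.ofReal_re]
    exact ⟨rfl, hr⟩
  have hmem := ae_restrict_mem (μ := (volume : Measure (Fin d → ℝ)))
    (measurableSet_Icc (a := (0 : Fin d → ℝ)) (b := 1))
  have hmeas : AEStronglyMeasurable (fun x => latticeFourier k x)
      (volume.restrict (Set.Icc (0 : Fin d → ℝ) 1)) := by
    simp only [latticeFourier_eq_integral hk]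
    exact he.aestronglyMeasurable_transform hk.ofReal.1
  have hinv : ∀ u, (k u : ℂ) = ∫ x in Set.Icc (0 : Fin d → ℝ) 1,
      ((latticeFourier k x).re : ℂ) * latticeChar u x := by
    intro u
    have hint : Integrable (fun p : (Fin d → ℝ) × (Fin d → ℤ) =>
        ((1 : ℂ) * (k p.2 : ℂ)) * latticeChar (u - p.2) p.1)
        ((volume.restrict (Set.Icc (0 : Fin d → ℝ) 1)).prod Measure.count) := by
      refine (((integrable_const (1 : ℂ)).mul_prod hk.ofReal)).mul_bdd (c := 1) ?_ ?_
      · exact (he.measurable.comp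
          ((measurable_snd.const_sub u).prodMk measurable_fst)).aestronglyMeasurable
      · exact Eventually.of_forall fun p => (he.norm_eq _ _).le
    calc (k u : ℂ) = ∫ t, (k t : ℂ) * (if u - t = 0 then 1 else 0) ∂Measure.count := by
          rw [integral_count_eq_of_forall_ne u]
          · simp
          · intro t ht
            rw [if_neg (sub_ne_zero.mpr ht.symm), mul_zero]
      _ = ∫ t, (∫ x in Set.Icc (0 : Fin d → ℝ) 1,
            ((1 : ℂ) * (k t : ℂ)) * latticeChar (u - t) x) ∂Measure.count := by
          congr 1
          ext t
          rw [integral_const_mul, integral_latticeChar, one_mul]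
      _ = ∫ x in Set.Icc (0 : Fin d → ℝ) 1, ∫ t,
            ((1 : ℂ) * (k t : ℂ)) * latticeChar (u - t) x ∂Measure.count :=
          (integral_integral_swap hint).symm
      _ = _ := by
          refine integral_congr_ae ?_
          filter_upwards [hmem] with x hx
          rw [(hre x hx).1, latticeFourier_eq_integral hk, ← integral_mul_const]
          congr 1
          ext t
          rw [he.map_sub]
          ring
  have hre_int : Integrable (fun x => (latticeFourier k x).re)
      (volume.restrict (Set.Icc (0 : Fin d → ℝ) 1)) := by
    refine Integrable.of_bound (Complex.continuous_re.comp_aestronglyMeasurable hmeas) M ?_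
    filter_upwards [hmem] with x hx
    rw [Real.norm_of_nonneg (hre x hx).2.1]
    exact (hre x hx).2.2
  refine ⟨⟨hk, hre_int, ?_, Eventually.of_forall hinv, ?_, ?_⟩, ?_⟩
  · filter_upwards [hmem] with x hx
    rw [(hre x hx).1, latticeFourier_eq_integral hk]
  · filter_upwards [hmem] with x hx using (hre x hx).2.1
  · filter_upwards [hmem] with x hx using (hre x hx).2.2
  · have h0 := hinv 0
    have h1 : ∀ x : Fin d → ℝ, latticeChar 0 x = 1 := by
      intro x
      simp [latticeChar]
    simp only [h1, mul_one] at h0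
    rw [integral_complex_ofReal] at h0
    exact (Complex.ofReal_injective h0).symm

theorem latticeDist_le_sum_abs (x y : Fin d → ℤ) :
    latticeDist x y ≤ ((∑ i, |x i - y i| : ℤ) : ℝ) := by
  unfold latticeDist
  refine Real.sqrt_le_iff.mpr ⟨?_, ?_⟩
  · exact_mod_cast Finset.sum_nonneg fun i _ => abs_nonneg _
  · push_cast
    refine le_trans (le_of_eq ?_) (Finset.sum_sq_le_sq_sum_of_nonneg fun i _ => abs_nonneg _)
    simp

/-- Walk from `s` to `s - u` by unit steps, `N` in all; the last point before the walk first leaves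
`A` is a boundary point. -/
theorem exists_mem_latticeBoundary {A : Set (Fin d → ℤ)} (N : ℕ) :
    ∀ s u : Fin d → ℤ, ∑ i, |u i| = N → s ∈ A → s - u ∉ A →
      ∃ y ∈ latticeBoundary A, ∑ i, |s i - y i| ≤ N := by
  induction N with
  | zero =>
    intro s u hu hs hsu
    have : u = 0 := by
      ext i
      have := (Finset.sum_eq_zero_iff_of_nonneg fun i _ => abs_nonneg (u i)).mp
        (by exact_mod_cast hu) i (Finset.mem_univ i)
      simpa using this
    simp [this, hs] at hsu
  | succ N ih =>
    intro s u hu hs hsu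
    obtain ⟨i, hi⟩ : ∃ i, u i ≠ 0 := by
      by_contra! h
      simp [h] at hu
      omega
    -- One unit step along a coordinate where `u` is nonzero, with the sign that shortens the
    -- remaining displacement `u - c` by exactly 1.
    set c : Fin d → ℤ := Pi.single i (u i).sign with hc
    have hc1 : ∑ j, |c j| = 1 := by
      have : ∀ j, |c j| = (Pi.single i 1 : Fin d → ℤ) j := by
        intro j
        by_cases hj : j = i
        · subst hj
          simp [hc, Int.abs_sign_of_ne_zero hi]
        · simp [hc, hj]
      simp [this]
    have hu' : ∑ j, |(u - c) j| = N := by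
      have : ∀ j, |(u - c) j| = |u j| - (Pi.single i 1 : Fin d → ℤ) j := by
        intro j
        by_cases hj : j = i
        · subst hj
          simp only [hc, Pi.sub_apply, Pi.single_eq_same]
          rcases lt_or_gt_of_ne hi with h | h
          · rw [Int.sign_eq_neg_one_of_neg h, abs_of_neg h, abs_of_nonpos (by omega)]
            ring
          · rw [Int.sign_eq_one_of_pos h, abs_of_pos h, abs_of_nonneg (by omega)]
        · simp [hc, hj]
      simp only [this, Finset.sum_sub_distrib, hu]
      simp
    by_cases hs' : s - c ∈ A
    · obtain ⟨y, hy, hd⟩ := ih (s - c) (u - c) hu' hs' (by simpa using hsu)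
      refine ⟨y, hy, ?_⟩
      calc ∑ j, |s j - y j| ≤ ∑ j, (|(s - c) j - y j| + |c j|) := by
            refine Finset.sum_le_sum fun j _ => ?_
            have := abs_add_le ((s - c) j - y j) (c j)
            rwa [Pi.sub_apply, show s j - c j - y j + c j = s j - y j by ring] at this
        _ ≤ _ := by
            rw [Finset.sum_add_distrib, hc1]
            push_cast
            linarith
    · refine ⟨s, ⟨hs, s - c, hs', ?_⟩, ?_⟩
      · simpa using hc1
      · simp
        positivity

/-- The discrete case: uniform Szegő asymptotics on the lattice. -/
theorem uniform_szego_latticeFourier {Θ : Type*} {M : ℝ} (hM : M < 1)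
    (K : Θ → (Fin d → ℤ) → ℝ) (W : ℕ → Set (Fin d → ℤ))
    (hK : ∀ θ, Integrable (K θ) Measure.count)
    (hKM : ∀ θ, ∀ x ∈ Set.Icc (0 : Fin d → ℝ) 1,
      latticeFourier (K θ) x ∈ Complex.ofReal '' Set.Icc 0 M)
    (hbdd : BddAbove (Set.range fun θ => K θ 0)) (hS : SupIntegrable Measure.count K)
    (hW : WindowCondition Measure.count latticeDist latticeBoundary W) :
    (∀ θ n, IsSelfAdjointTraceClass (windowOperator (K θ) (hK θ) (W n)) ∧
      0 < fredholmDet (windowOperator (K θ) (hK θ) (W n))) ∧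
    (∀ θ, IntegrableOn (fun x => Real.log (1 - (latticeFourier (K θ) x).re))
      (Set.Icc (0 : Fin d → ℝ) 1) volume) ∧
    Tendsto (fun n => ⨆ θ, ENNReal.ofReal
        |1 / Measure.count.real (W n) *
            Real.log (fredholmDet (windowOperator (K θ) (hK θ) (W n)))
          - ∫ x in Set.Icc (0 : Fin d → ℝ) 1,
              Real.log (1 - (latticeFourier (K θ) x).re)|) atTop (𝓝 0) := by
  obtain ⟨C, hC⟩ := hbdd
  have hWf : ∀ n, Measure.count (W n) ≠ ∞ := fun n =>
    (Measure.count_apply_lt_top.mpr (isCompact_iff_finite.mp (hW.isCompact n))).ne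
  have hp := fun θ => isFourierPair_latticeFourier (M := max M 0) (hK θ) fun x hx =>
    Set.image_mono (Set.Icc_subset_Icc_right (le_max_left _ _)) (hKM θ x hx)
  refine uniform_szego (M := max M 0) (C := C) hK isCharacterFamily_latticeChar
    besselInequality_latticeChar (le_max_right _ _) (max_lt hM one_pos) (fun θ => (hp θ).1)
    (fun θ => ?_) hS (fun n => (W n).to_countable.measurableSet) hWf hW.eventually_pos
    -- The walk controls the `ℓ¹` distance to the boundary, which dominates the Euclidean distance
    -- used in the window condition.
    fun u => hW.tendsto_translate_diff hWf (R := ((∑ i, |u i|).toNat : ℝ)) fun n s hs hsu => ?_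
  · rw [(hp θ).2]
    exact hC ⟨θ, rfl⟩
  · obtain ⟨y, hy, hd⟩ := exists_mem_latticeBoundary (∑ i, |u i|).toNat s u
      (Int.toNat_of_nonneg (Finset.sum_nonneg fun i _ => abs_nonneg _)).symm hs hsu
    exact ⟨y, hy, (latticeDist_le_sum_abs s y).trans (by exact_mod_cast hd)⟩

end Lattice

theorem proposition2 {Θ : Type*} (d : ℕ) (M : ℝ) (hM : M < 1) :
    -- the continuous case `X = ℝ^d`
    (∀ (K : Θ → EuclideanSpace ℝ (Fin d) → ℝ) (W : ℕ → Set (EuclideanSpace ℝ (Fin d)))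
        (hK : ∀ θ, Integrable (K θ) volume),
        (∀ θ, ContinuousAt (K θ) 0) →
        (∀ θ, Integrable (𝓕 (fun t => (K θ t : ℂ))) volume) →
        (∀ θ x, 𝓕 (fun t => (K θ t : ℂ)) x ∈ Complex.ofReal '' Set.Icc 0 M) →
        BddAbove (Set.range fun θ => K θ 0) →
        SupIntegrable volume K →
        WindowCondition volume dist frontier W →
        (∀ θ n, IsSelfAdjointTraceClass (windowOperator (K θ) (hK θ) (W n)) ∧
          0 < fredholmDet (windowOperator (K θ) (hK θ) (W n))) ∧
        (∀ θ, Integrable (fun x => Real.log (1 - (𝓕 (fun t => (K θ t : ℂ)) x).re)) volume) ∧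
        Tendsto (fun n => ⨆ θ, ENNReal.ofReal
            |1 / volume.real (W n) *
                Real.log (fredholmDet (windowOperator (K θ) (hK θ) (W n)))
              - ∫ x, Real.log (1 - (𝓕 (fun t => (K θ t : ℂ)) x).re)|) atTop (𝓝 0)) ∧
    -- the discrete case `X = ℤ^d`
    (∀ (K : Θ → (Fin d → ℤ) → ℝ) (W : ℕ → Set (Fin d → ℤ))
        (hK : ∀ θ, Integrable (K θ) Measure.count),
        (∀ θ, ∀ x ∈ Set.Icc (0 : Fin d → ℝ) 1,
          latticeFourier (K θ) x ∈ Complex.ofReal '' Set.Icc 0 M) →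
        BddAbove (Set.range fun θ => K θ 0) →
        SupIntegrable Measure.count K →
        WindowCondition Measure.count latticeDist latticeBoundary W →
        (∀ θ n, IsSelfAdjointTraceClass (windowOperator (K θ) (hK θ) (W n)) ∧
          0 < fredholmDet (windowOperator (K θ) (hK θ) (W n))) ∧
        (∀ θ, IntegrableOn (fun x => Real.log (1 - (latticeFourier (K θ) x).re))
          (Set.Icc (0 : Fin d → ℝ) 1) volume) ∧
        Tendsto (fun n => ⨆ θ, ENNReal.ofReal
            |1 / Measure.count.real (W n) *
                Real.log (fredholmDet (windowOperator (K θ) (hK θ) (W n)))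
              - ∫ x in Set.Icc (0 : Fin d → ℝ) 1,
                  Real.log (1 - (latticeFourier (K θ) x).re)|) atTop (𝓝 0)) := by
  exact ⟨fun K W hK => uniform_szego_fourier hM K W hK,
    fun K W hK => uniform_szego_latticeFourier hM K W hK⟩
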